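/- Let $A$ be a finite alphabet, let $T$ be the Cayley tree of $A^*$ (the rooted tree whose vertices are the finite words over $A$, whose root is the empty word, and in which $u$ is joined to $ua$ for every word $u$ and letter $a$), and let $\nu$ be the product measure on $\partial T=A^{\omega}$ giving each cylinder $uA^{\omega}$ the measure $|A|^{-|u|}$. Let $\Gamma$ be a group acting on $T$ by rooted automorphisms, spherically transitively (i.e. transitively on $A^k$ for every $k\ge 0$), and let $S$ be a non-empty finite symmetric generating set of $\Gamma$. For a subgroup $Q\le\Gamma$, the Schreier graph $\mathrm{Sch}(\Gamma,Q,S)$ has vertex set $\Gamma/Q$ and edges from $gQ$ to $sgQ$ $(s\in S)$; its Markov operator on the real Hilbert space $\ell^2(\Gamma/Q)$ is $M_Qf(gQ)=\frac1{|S|}\sum_{s\in S}f(sgQ)$. If $E$ is the (projection-valued) spectral measure of the self-adjoint operator $M_{\{1\}}$ on $\ell^2(\Gamma)$, the Kesten spectral measure of the Cayley graph $\mathrm{Sch}(\Gamma,1,S)$ is $\mu^{\Gamma}(B)=\langle E(B)\delta_1,\delta_1\rangle$ for Borel sets $B$. Let $w\in A^{\omega}$, let $w_k$ be its prefix of length $k$,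 put $P=\mathrm{St}_\Gamma(w)$ and $P_k=\mathrm{St}_\Gamma(w_k)$ (so the $P_k$ have finite index and $\bigcap_k P_k=P$), and let $X=\mathrm{Sch}(\Gamma,P,S)$ and $X_k=\mathrm{Sch}(\Gamma,P_k,S)$. The Kesten–von Neumann–Serre (KNS) spectral measure of $X$ with respect to $\{X_k\}$ is the probability measure $\mu$ supported in $[-1,1]$ that is the weak limit, as $k\to\infty$, of the eigenvalue counting measures $$\mu_k=\sum_{\lambda\in\mathrm{Sp}(M_{P_k})}\frac{\#_k(\lambda)}{|\Gamma/P_k|}\,\delta_\lambda ,$$ where $\#_k(\lambda)$ is the multiplicity of the eigenvalue $\lambda$ of $M_{P_k}$. Then both measures exist and are uniquely determined, and the following are equivalent: 1. the KNS spectral measure $\mu$ of $X$ with respect to the approximating sequence $\{X_k\}$ coincides with the Kesten spectral measure $\mu^{\Gamma}$ of the simple random walk on the Cayley graph of $\Gamma$; 2. the action of $\Gamma$ on $(\partial T,\nu)$ is free in the sense of ergodic theory: for every $1\ne\gamma\in\Gamma$, the set $\{x\in\partial T\mid \gamma x=x\}$ has $\nu$-measure zero. -/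

import Mathlib

noncomputable section

open scoped ENNReal BoundedContinuousFunction
open MeasureTheory

namespace TreeSpectra

/-! ### The rooted tree of words and its boundary -/

/-- An action of a group `Γ` on the set `A*` of finite words by rooted automorphisms of the Cayley
tree of `A*`, the tree with root the empty word and with an edge from `u` to `ua` for each word `u`
and each letter `a`: the root is fixed and edges are sent to edges. -/
class IsRootedTreeAction (Γ A : Type*) [Group Γ] [MulAction Γ (List A)] : Prop where
  smul_nil : ∀ g : Γ, g • ([] : List A) = []
  smul_child : ∀ (g : Γ) (u : List A) (a : A), ∃ b : A, g • (u ++ [a]) = g • u ++ [b]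

/-- The action is transitive on every level of the tree. -/
def SphericallyTransitive (Γ A : Type*) [Group Γ] [MulAction Γ (List A)] : Prop :=
  ∀ u v : List A, u.length = v.length → ∃ g : Γ, g • u = v

/-- The boundary of the tree: infinite words, i.e. infinite paths from the root. -/
def Boundary (A : Type*) := ℕ → A

/-- The prefix of length `k` of an infinite word. -/
def Boundary.take {A : Type*} (w : Boundary A) (k : ℕ) : List A :=
  (List.range k).map (fun i => w i)

theorem Boundary.take_succ {A : Type*} (w : Boundary A) (k : ℕ) :
    w.take (k + 1) = w.take k ++ [w k] := by
  simp [Boundary.take, List.range_succ]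

theorem Boundary.length_take {A : Type*} (w : Boundary A) (k : ℕ) :
    (w.take k).length = k := by
  simp [Boundary.take]

section Action

variable {Γ A : Type*} [Group Γ] [MulAction Γ (List A)] [IsRootedTreeAction Γ A]

theorem length_smul (g : Γ) (u : List A) : (g • u).length = u.length := by
  induction u using List.reverseRecOn with
  | nil => simp [IsRootedTreeAction.smul_nil]
  | append_singleton u a ih =>
    obtain ⟨b, hb⟩ := IsRootedTreeAction.smul_child g u a
    simp [hb, ih]

theorem lt_length_smul_take (g : Γ) (w : Boundary A) (n : ℕ) :
    n < (g • w.take (n + 1)).length := by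
  simp [length_smul, Boundary.length_take]

/-- The `n`-th letter of `g • w` is the `n`-th letter of the image under `g` of any sufficiently
long prefix of `w`. -/
instance : SMul Γ (Boundary A) where
  smul g w := fun n => (g • w.take (n + 1))[n]'(lt_length_smul_take g w n)

theorem smul_boundary_apply (g : Γ) (w : Boundary A) (n : ℕ) :
    (g • w) n = (g • w.take (n + 1))[n]'(lt_length_smul_take g w n) := rfl

/-- The prefixes of `g • w` are the images under `g` of the prefixes of `w`. -/
theorem take_smul (g : Γ) (w : Boundary A) (n : ℕ) :
    (g • w).take n = g • w.take n := by
  induction n with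
  | zero => simp [Boundary.take, IsRootedTreeAction.smul_nil]
  | succ n ih =>
    obtain ⟨b, hb⟩ := IsRootedTreeAction.smul_child g (w.take n) (w n)
    rw [Boundary.take_succ, ih, smul_boundary_apply]
    simp only [Boundary.take_succ, hb]
    simp [length_smul, Boundary.length_take]

/-- The induced action on the boundary. -/
instance : MulAction Γ (Boundary A) where
  one_smul w := by
    funext n
    rw [smul_boundary_apply]
    simp [Boundary.take]
  mul_smul g h w := by
    funext n
    simp only [smul_boundary_apply, take_smul, mul_smul]

end Action

/-- The Borel σ-algebra of `A^ω`, generated by the cylinder sets. -/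
instance (A : Type*) : MeasurableSpace (Boundary A) :=
  @MeasurableSpace.pi ℕ (fun _ => A) (fun _ => ⊤)

/-- The product (Bernoulli) measure on the boundary, the cylinder of all infinite words with
prefix `u` having measure `1 / |A| ^ |u|`. -/
def boundaryMeasure (A : Type*) [Finite A] [Nonempty A] : Measure (Boundary A) :=
  letI : MeasurableSpace A := ⊤
  Measure.infinitePi (fun _ : ℕ => ProbabilityTheory.uniformOn (Set.univ : Set A))

/-- Freeness of the boundary action in the sense of ergodic theory. -/
def ErgodicallyFree (Γ A : Type*) [Group Γ] [MulAction Γ (List A)] [IsRootedTreeAction Γ A]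
    [Finite A] [Nonempty A] : Prop :=
  ∀ g : Γ, g ≠ 1 → boundaryMeasure A {w : Boundary A | g • w = w} = 0

/-! ### Spectral measures of self-adjoint operators -/

/-- A projection-valued Borel measure on `ℝ`, acting on the real Hilbert space `H`
(only the values on Borel sets are relevant). -/
structure ProjectionValuedMeasure (H : Type*) [NormedAddCommGroup H] [InnerProductSpace ℝ H]
    [CompleteSpace H] where
  toFun : Set ℝ → H →L[ℝ] H
  isStarProjection : ∀ B, MeasurableSet B → IsStarProjection (toFun B)
  univ : toFun Set.univ = 1
  inter : ∀ B C, MeasurableSet B → MeasurableSet C → toFun (B ∩ C) = toFun B * toFun C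
  hasSum_iUnion : ∀ B : ℕ → Set ℝ, (∀ i, MeasurableSet (B i)) →
    Pairwise (Function.onFun Disjoint B) → ∀ x, HasSum (fun i => toFun (B i) x) (toFun (⋃ i, B i) x)

namespace ProjectionValuedMeasure

variable {H : Type*} [NormedAddCommGroup H] [InnerProductSpace ℝ H] [CompleteSpace H]

theorem inner_nonneg (E : ProjectionValuedMeasure H) (x : H) {B : Set ℝ} (hB : MeasurableSet B) :
    0 ≤ inner ℝ (E.toFun B x) x := by
  have h := E.isStarProjection B hB
  have hi : E.toFun B (E.toFun B x) = E.toFun B x := by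
    have := congrArg (fun T : H →L[ℝ] H => T x) h.isIdempotentElem.eq
    simpa using this
  have hs := h.isSelfAdjoint.isSymmetric (E.toFun B x) x
  simp only [ContinuousLinearMap.coe_coe] at hs
  rw [hi] at hs
  rw [hs]
  exact real_inner_self_nonneg

theorem apply_empty (E : ProjectionValuedMeasure H) (x : H) : E.toFun ∅ x = 0 := by
  have h := E.hasSum_iUnion (fun _ => ∅) (fun _ => MeasurableSet.empty)
    (fun _ _ _ => disjoint_bot_left) x
  have := h.summable.tendsto_atTop_zero
  exact tendsto_nhds_unique tendsto_const_nhds this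

/-- The Borel measure `B ↦ ⟨E(B) x, x⟩` on `ℝ`. -/
def measure (E : ProjectionValuedMeasure H) (x : H) : Measure ℝ :=
  Measure.ofMeasurable (fun B _ => ENNReal.ofReal (inner ℝ (E.toFun B x) x))
    (by simp [E.apply_empty])
    (by
      intro B hB hd
      have h : HasSum (fun i => inner ℝ (E.toFun (B i) x) x)
          (inner ℝ (E.toFun (⋃ i, B i) x) x) := by
        have := (E.hasSum_iUnion B hB hd x).mapL (innerSL ℝ x)
        simpa [real_inner_comm] using this
      rw [← h.tsum_eq, ENNReal.ofReal_tsum_of_nonneg (fun i => E.inner_nonneg x (hB i)) h.summable])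

theorem measure_apply (E : ProjectionValuedMeasure H) (x : H) {B : Set ℝ} (hB : MeasurableSet B) :
    E.measure x B = ENNReal.ofReal (inner ℝ (E.toFun B x) x) :=
  Measure.ofMeasurable_apply B hB

/-- `E` is the spectral measure of the bounded self-adjoint operator `T`: it is carried by
`[-‖T‖, ‖T‖]` and `T = ∫ t dE(t)`. As `T` is self-adjoint, the latter identity is that of the
quadratic forms of both sides. -/
structure IsSpectralMeasureOf (E : ProjectionValuedMeasure H) (T : H →L[ℝ] H) : Prop where
  isSelfAdjoint : IsSelfAdjoint T
  carried : E.toFun (Set.Icc (-‖T‖) ‖T‖) = 1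
  integral : ∀ x, inner ℝ (T x) x = ∫ t, t ∂(E.measure x)

end ProjectionValuedMeasure

/-! ### Markov operators of Schreier graphs -/

/-- The real Hilbert space `ℓ²(V)`. -/
abbrev L2 (V : Type*) := lp (fun _ : V => ℝ) 2

/-- The isometry `f ↦ f ∘ σ` of `ℓ²(V)`. -/
def compPerm {V : Type*} (σ : Equiv.Perm V) : L2 V →ₗᵢ[ℝ] L2 V where
  toFun f := ⟨fun v => f (σ v), by
    have h := (lp.memℓp f).summable (by norm_num)
    exact memℓp_gen (h.comp_injective σ.injective)⟩
  map_add' _ _ := rfl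
  map_smul' _ _ := rfl
  norm_map' f := by
    rw [lp.norm_eq_tsum_rpow (by norm_num), lp.norm_eq_tsum_rpow (by norm_num)]
    congr 1
    exact σ.tsum_eq (fun v => ‖f v‖ ^ (2 : ℝ≥0∞).toReal)

variable {Γ : Type*} [Group Γ]

/-- The Markov operator of the simple random walk on the (left) Schreier graph of `Γ` with respect
to `P` and the finite set `S`: the vertices are the left cosets `gP`, and the edges are
`gP — sgP` for `s ∈ S`. -/
def markov (S : Finset Γ) (P : Subgroup Γ) : L2 (Γ ⧸ P) →L[ℝ] L2 (Γ ⧸ P) :=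
  (1 / (S.card : ℝ)) • ∑ s ∈ S, (compPerm (MulAction.toPerm s)).toContinuousLinearMap

theorem markov_apply (S : Finset Γ) (P : Subgroup Γ) (f : L2 (Γ ⧸ P)) (v : Γ ⧸ P) :
    markov S P f v = 1 / (S.card : ℝ) * ∑ s ∈ S, f (s • v) := by
  simp only [markov, FunLike.coe_smul, Pi.smul_apply, lp.coeFn_smul, smul_eq_mul,
    sum_apply, lp.coeFn_sum, Finset.sum_apply]
  rfl

open Classical in
/-- `ν` is the Kesten spectral measure `B ↦ ⟨E(B) δ_v, δ_v⟩` of the Schreier graph of `Γ` with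
respect to `P` and `S`, at the vertex `v`, with `E` the spectral measure of the Markov operator. -/
def IsKestenMeasure (S : Finset Γ) (P : Subgroup Γ) (v : Γ ⧸ P) (ν : Measure ℝ) : Prop :=
  ∃ E : ProjectionValuedMeasure (L2 (Γ ⧸ P)),
    E.IsSpectralMeasureOf (markov S P) ∧ ν = E.measure (lp.single 2 v (1 : ℝ))

/-- `ν` is the Kesten spectral measure of the Cayley graph of `Γ` (the Schreier graph with respect
to the trivial subgroup) at the identity. -/
def IsCayleyKestenMeasure (S : Finset Γ) (ν : Measure ℝ) : Prop :=
  IsKestenMeasure S (⊥ : Subgroup Γ) ((1 : Γ) : Γ ⧸ (⊥ : Subgroup Γ)) ν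

/-- The eigenvalue counting measure of the finite Schreier graph with respect to a subgroup `Q` of
finite index: the sum over the eigenvalues `t` of the Markov operator of the point masses at `t`,
each weighted by the multiplicity of `t` divided by the number of vertices. -/
def eigenvalueMeasure (S : Finset Γ) (Q : Subgroup Γ) : Measure ℝ :=
  Measure.sum fun t : ℝ =>
    ((Module.finrank ℝ (Module.End.eigenspace (markov S Q : L2 (Γ ⧸ Q) →ₗ[ℝ] L2 (Γ ⧸ Q)) t) : ℝ≥0∞)
      / (Nat.card (Γ ⧸ Q) : ℝ≥0∞)) • Measure.dirac t

/-- `μ` is the Kesten-von Neumann-Serre spectral measure of the Schreier graph of `Γ` with respect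
to `P` and `S`, for the approximating sequence of the finite Schreier graphs given by the
subgroups `Q k` of finite index with intersection `P`: a probability measure supported in `[-1, 1]`
to which the eigenvalue counting measures converge weakly. -/
structure IsKNSMeasure (S : Finset Γ) (P : Subgroup Γ) (Q : ℕ → Subgroup Γ) (μ : Measure ℝ) :
    Prop where
  finiteIndex : ∀ k, (Q k).FiniteIndex
  iInf_eq : ⨅ k, Q k = P
  isProbabilityMeasure : IsProbabilityMeasure μ
  supported : μ (Set.Icc (-1) 1)ᶜ = 0
  weakly : ∀ f : ℝ →ᵇ ℝ, Filter.Tendsto (fun k => ∫ t, f t ∂(eigenvalueMeasure S (Q k)))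
    Filter.atTop (nhds (∫ t, f t ∂μ))

end TreeSpectra

end

/-!
Both measures are carried by `[-1, 1]`, so each is determined by its moments, and the theorem
compares moments.

Let `M` be the Markov operator of a Schreier graph `Γ/Q`. Expanding `M ^ n` over the words
`σ = s₁ ⋯ sₙ` of length `n` in `S` gives `⟨M ^ n δ_v, δ_v⟩ = |S|⁻ⁿ #{σ | σ v = v}`
(`inner_markov_pow_single`). For `Q` trivial, the `n`-th moment of the Kesten measure is the average
over the words `σ` of `1` or `0`, according as `σ = 1` in `Γ` or not
(`integral_pow_of_isCayleyKestenMeasure`). For `Q` of finite index, the `n`-th moment of the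
eigenvalue counting measure is the normalized trace of `M ^ n`, which is the average over `σ` of the
proportion of points of `Γ/Q` that `σ` fixes (`integral_pow_eigenvalueMeasure`). When `Q` is the
stabilizer of a word of length `k`, transitivity on the `k`-th level turns this proportion into the
measure of the set of `x` in the boundary whose prefix of length `k` is fixed by `σ`
(`card_fixed_div_card`). These sets decrease to the set of fixed points of `σ`, so the moments
converge to the averages of `ν {x | σ x = x}` (`tendsto_moment_eigenvalueMeasure`).

The average of `ν {x | σ x = x}` dominates the average of `1_{σ = 1}` word by word. The moments
therefore agree exactly when `ν {x | σ x = x} = 0` for each word `σ ≠ 1`; as every element of `Γ` is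
represented by a word, this is freeness (`ergodicallyFree_iff_moments`).

Existence of the limiting measure follows from weak compactness of the measures of bounded mass on a
compact interval (`exists_measure_of_tendsto_moments`). Existence and uniqueness of the Kesten
measure rest on the spectral theorem for a self-adjoint operator `T` of a real Hilbert space, which
is proved here. The compressions of `T` to the spans of `x, T x, …, T ^ d x` are diagonalizable, and
their spectral measures at `x` have a limit with moments `⟨T ^ n x, x⟩` (`scalarMeasure`). The
spectral projection on a Borel set `B` is the strong limit of `p n (T)` for polynomials `p n`
tending to `1_B` in `L²` of these measures (`spectralMeasure`). Conversely, for every spectral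
measure `E` of `T` the measures `⟨E(·) x, x⟩` have the same moments, because the Riemann sums of
`∫ t dE` converge to `T` in norm (`ProjectionValuedMeasure.integral_pow_measure`).
-/

namespace TreeSpectra

open MeasureTheory Filter Topology Polynomial
open scoped NNReal ENNReal BoundedContinuousFunction

/-! ### Measures on a compact interval and their moments -/

theorem restrict_Icc_eq {c : ℝ} {m : Measure ℝ} (hm : m (Set.Icc (-c) c)ᶜ = 0) :
    m.restrict (Set.Icc (-c) c) = m :=
  Measure.restrict_eq_self_of_ae_mem hm

theorem integrable_of_continuous {c : ℝ} {m : Measure ℝ} [IsFiniteMeasure m]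
    (hm : m (Set.Icc (-c) c)ᶜ = 0) {f : ℝ → ℝ} (hf : Continuous f) : Integrable f m := by
  have h : IntegrableOn f (Set.Icc (-c) c) m := hf.continuousOn.integrableOn_compact isCompact_Icc
  rwa [IntegrableOn, restrict_Icc_eq hm] at h

theorem ae_mem_Icc {c : ℝ} {m : Measure ℝ} (hm : m (Set.Icc (-c) c)ᶜ = 0) :
    ∀ᵐ t ∂m, t ∈ Set.Icc (-c) c := hm

theorem abs_integral_sub_le {c : ℝ} {m : Measure ℝ} [IsFiniteMeasure m]
    (hm : m (Set.Icc (-c) c)ᶜ = 0) {f g : ℝ → ℝ} (hf : Continuous f) (hg : Continuous g) {ε : ℝ}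
    (h : ∀ t ∈ Set.Icc (-c) c, |f t - g t| ≤ ε) :
    |∫ t, f t ∂m - ∫ t, g t ∂m| ≤ ε * m.real Set.univ := by
  rw [← integral_sub (integrable_of_continuous hm hf) (integrable_of_continuous hm hg)]
  have h' : ∀ᵐ t ∂m, ‖f t - g t‖ ≤ ε := by
    filter_upwards [ae_mem_Icc hm] with t ht using h t ht
  exact norm_integral_le_of_norm_le_const h'

theorem integral_eval_eq_sum {c : ℝ} {m : Measure ℝ} [IsFiniteMeasure m]
    (hm : m (Set.Icc (-c) c)ᶜ = 0) (p : ℝ[X]) :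
    ∫ t, p.eval t ∂m = ∑ i ∈ Finset.range (p.natDegree + 1), p.coeff i * ∫ t, t ^ i ∂m := by
  simp_rw [eval_eq_sum_range]
  rw [integral_finsetSum]
  · simp_rw [integral_const_mul]
  · exact fun i _ => (integrable_of_continuous hm (continuous_pow i)).const_mul _

/-- Convergence of moments implies convergence of the integrals of all continuous functions, by
the Weierstrass approximation theorem. -/
theorem tendsto_integral_of_tendsto_moments {c : ℝ} {μ : ℕ → Measure ℝ} {ν : Measure ℝ}
    [∀ k, IsFiniteMeasure (μ k)] [IsFiniteMeasure ν] (hμ : ∀ k, μ k (Set.Icc (-c) c)ᶜ = 0)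
    (hν : ν (Set.Icc (-c) c)ᶜ = 0)
    (h : ∀ n : ℕ, Tendsto (fun k => ∫ t, t ^ n ∂(μ k)) atTop (𝓝 (∫ t, t ^ n ∂ν)))
    {f : ℝ → ℝ} (hf : Continuous f) :
    Tendsto (fun k => ∫ t, f t ∂(μ k)) atTop (𝓝 (∫ t, f t ∂ν)) := by
  have hmass : Tendsto (fun k => (μ k).real Set.univ) atTop (𝓝 (ν.real Set.univ)) := by
    simpa using h 0
  have hpoly (p : ℝ[X]) :
      Tendsto (fun k => ∫ t, p.eval t ∂(μ k)) atTop (𝓝 (∫ t, p.eval t ∂ν)) := by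
    simp_rw [integral_eval_eq_sum (hμ _), integral_eval_eq_sum hν]
    exact tendsto_finsetSum _ fun i _ => (h i).const_mul _
  rw [Metric.tendsto_atTop]
  intro ε hε
  -- `C` bounds the masses of `ν` and of `μ k` for large `k`
  set C := ν.real Set.univ + 1 with hC
  have hC0 : 0 < C := by positivity
  obtain ⟨p, hp⟩ := exists_polynomial_near_of_continuousOn (-c) c f hf.continuousOn
    (ε / (3 * C)) (by positivity)
  have hp' : ∀ t ∈ Set.Icc (-c) c, |f t - p.eval t| ≤ ε / (3 * C) :=
    fun t ht => by rw [abs_sub_comm]; exact (hp t ht).le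
  have h1 := (Metric.tendsto_atTop.1 (hpoly p)) (ε / 3) (by positivity)
  have h2 := hmass.eventually (gt_mem_nhds (show ν.real Set.univ < C by simp [hC]))
  obtain ⟨N, hN⟩ := h1
  obtain ⟨N', hN'⟩ := eventually_atTop.1 h2
  refine ⟨max N N', fun k hk => ?_⟩
  have a1 := hN k (le_trans (le_max_left _ _) hk)
  have a2 := hN' k (le_trans (le_max_right _ _) hk)
  have a3 := abs_integral_sub_le (hμ k) hf p.continuous hp'
  have a4 := abs_integral_sub_le hν hf p.continuous hp'
  have e0 : ε / (3 * C) * C = ε / 3 := by field_simp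
  have a5 : ε / (3 * C) * (μ k).real Set.univ < ε / 3 := by
    rw [← e0]; gcongr
  have a6 : ε / (3 * C) * ν.real Set.univ < ε / 3 := by
    rw [← e0]; gcongr; simp [hC]
  rw [Real.dist_eq] at a1 ⊢
  rw [abs_lt] at *
  rw [abs_le] at a3 a4
  constructor <;> linarith

theorem ext_of_moments {c : ℝ} {μ ν : Measure ℝ} [IsFiniteMeasure μ] [IsFiniteMeasure ν]
    (hμ : μ (Set.Icc (-c) c)ᶜ = 0) (hν : ν (Set.Icc (-c) c)ᶜ = 0)
    (h : ∀ n : ℕ, ∫ t, t ^ n ∂μ = ∫ t, t ^ n ∂ν) : μ = ν := by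
  refine ext_of_forall_integral_eq_of_IsFiniteMeasure fun f => ?_
  refine tendsto_nhds_unique (tendsto_const_nhds (f := atTop (α := ℕ))) ?_
  exact tendsto_integral_of_tendsto_moments (fun _ => hμ) hν
    (fun n => by rw [h n]; exact tendsto_const_nhds) f.continuous

/-- The power function truncated outside of `[-c, c]`. -/
noncomputable def truncPow (c : ℝ) (hc : 0 ≤ c) (n : ℕ) : ℝ →ᵇ ℝ :=
  BoundedContinuousFunction.ofNormedAddCommGroup (fun t => (max (-c) (min c t)) ^ n)
    (by fun_prop) (c ^ n) fun t => by
      rw [norm_pow]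
      gcongr
      rw [Real.norm_eq_abs, abs_le]
      exact ⟨le_max_left _ _, max_le (by linarith) (min_le_left _ _)⟩

theorem integral_truncPow {c : ℝ} (hc : 0 ≤ c) {m : Measure ℝ} (hm : m (Set.Icc (-c) c)ᶜ = 0)
    (n : ℕ) : ∫ t, truncPow c hc n t ∂m = ∫ t, t ^ n ∂m := by
  refine integral_congr_ae ?_
  filter_upwards [ae_mem_Icc hm] with t ht
  change (max (-c) (min c t)) ^ n = t ^ n
  rw [min_eq_right ht.2, max_eq_right ht.1]

/-- Solution of the moment problem for a limit of moment sequences: a limiting measure exists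
because the measures of bounded mass on a compact interval form a weakly compact set. -/
theorem exists_measure_of_tendsto_moments {c : ℝ} (hc : 0 ≤ c) {μ : ℕ → Measure ℝ}
    [∀ k, IsFiniteMeasure (μ k)] (hμ : ∀ k, μ k (Set.Icc (-c) c)ᶜ = 0) {a : ℕ → ℝ}
    (h : ∀ n : ℕ, Tendsto (fun k => ∫ t, t ^ n ∂(μ k)) atTop (𝓝 (a n))) :
    ∃ ν : Measure ℝ, IsFiniteMeasure ν ∧ ν (Set.Icc (-c) c)ᶜ = 0 ∧
      ∀ n : ℕ, ∫ t, t ^ n ∂ν = a n := by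
  have hmass : Tendsto (fun k => (μ k).real Set.univ) atTop (𝓝 (a 0)) := by simpa using h 0
  obtain ⟨C, hC⟩ := hmass.bddAbove_range
  let μ' : ℕ → FiniteMeasure ℝ := fun k => ⟨μ k, inferInstance⟩
  have hcpt := isCompact_setOfPred_finiteMeasure_le_of_isCompact (E := ℝ) C.toNNReal
    (isCompact_Icc (a := -c) (b := c))
  have hmem (k : ℕ) : μ' k ∈ {μ : FiniteMeasure ℝ | μ.mass ≤ C.toNNReal ∧
      μ (Set.Icc (-c) c)ᶜ = 0} := by
    refine ⟨?_, ?_⟩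
    · have := hC ⟨k, rfl⟩
      exact NNReal.le_toNNReal_of_coe_le this
    · rw [FiniteMeasure.null_iff_toMeasure_null]
      exact hμ k
  obtain ⟨ν, hν, hcl⟩ := hcpt.exists_mapClusterPt (f := atTop) (u := μ')
    (tendsto_principal.2 (Eventually.of_forall hmem))
  have hν0 : (ν : Measure ℝ) (Set.Icc (-c) c)ᶜ = 0 :=
    (FiniteMeasure.null_iff_toMeasure_null _ _).1 hν.2
  refine ⟨ν, inferInstance, hν0, fun n => ?_⟩
  -- moments are weakly continuous on measures carried by `[-c, c]`, as they can be truncated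
  have hcont : Continuous fun m : FiniteMeasure ℝ => ∫ t, truncPow c hc n t ∂(m : Measure ℝ) :=
    FiniteMeasure.continuous_integral_boundedContinuousFunction _
  have h1 := hcl.tendsto_comp (hcont.tendsto ν)
  have h2 : Tendsto ((fun m : FiniteMeasure ℝ => ∫ t, truncPow c hc n t ∂(m : Measure ℝ)) ∘ μ')
      atTop (𝓝 (a n)) := by
    refine (h n).congr fun k => ?_
    exact (integral_truncPow hc (hμ k) n).symm
  rw [← integral_truncPow hc hν0]
  exact eq_of_nhds_neBot (h1.clusterPt.mono h2)

/-- Indicator functions are limits of polynomials in `L²` of a finite measure on a compact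
interval. -/
theorem exists_polynomial_tendsto_indicator {c : ℝ} {m : Measure ℝ} [IsFiniteMeasure m]
    (hm : m (Set.Icc (-c) c)ᶜ = 0) {B : Set ℝ} (hB : MeasurableSet B) :
    ∃ p : ℕ → ℝ[X], Tendsto (fun n => ∫ t, ((p n).eval t - B.indicator 1 t) ^ 2 ∂m)
      atTop (𝓝 0) := by
  have key : ∀ ε : ℝ, 0 < ε → ∃ p : ℝ[X], ∫ t, (p.eval t - B.indicator 1 t) ^ 2 ∂m < ε := by
    intro ε hε
    have hind : MemLp (B.indicator (1 : ℝ → ℝ)) (ENNReal.ofReal 2) m :=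
      (memLp_const (1 : ℝ)).indicator hB
    obtain ⟨g, hg, hgm⟩ := hind.exists_boundedContinuous_integral_rpow_sub_le
      (show (0 : ℝ) < 2 by norm_num) (show 0 < ε / 8 by positivity)
    set M := m.real Set.univ
    -- `M + 1` instead of `M`, as `m` may vanish
    obtain ⟨p, hp⟩ := exists_polynomial_near_of_continuousOn (-c) c g g.continuous.continuousOn
      (Real.sqrt (ε / (8 * (M + 1)))) (by positivity)
    refine ⟨p, ?_⟩
    have i1 : Integrable (fun t => (B.indicator (1 : ℝ → ℝ) t - g t) ^ 2) m := by
      have : MemLp (fun t => B.indicator (1 : ℝ → ℝ) t - g t) 2 m := by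
        have := hind.sub hgm
        rwa [ENNReal.ofReal_ofNat] at this
      exact this.integrable_sq
    have i2 : Integrable (fun t => (p.eval t - g t) ^ 2) m :=
      integrable_of_continuous hm (by fun_prop)
    have hg' : ∫ t, (B.indicator (1 : ℝ → ℝ) t - g t) ^ 2 ∂m ≤ ε / 8 := by
      refine le_trans (le_of_eq ?_) hg
      congr 1
      ext t
      simp
    have hp' : ∫ t, (p.eval t - g t) ^ 2 ∂m ≤ ε / (8 * (M + 1)) * M := by
      have : ‖∫ t, (p.eval t - g t) ^ 2 ∂m‖ ≤ ε / (8 * (M + 1)) * M := by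
        refine norm_integral_le_of_norm_le_const ?_
        filter_upwards [ae_mem_Icc hm] with t ht
        rw [norm_pow, Real.norm_eq_abs, ← Real.le_sqrt (abs_nonneg _) (by positivity)]
        exact (hp t ht).le
      exact (le_abs_self _).trans this
    have hM : ε / (8 * (M + 1)) * M ≤ ε / 8 := by
      have hM0 : 0 ≤ M := measureReal_nonneg
      rw [div_mul_eq_mul_div, div_le_div_iff₀ (by positivity) (by positivity)]
      nlinarith
    calc ∫ t, (p.eval t - B.indicator 1 t) ^ 2 ∂m
        ≤ ∫ t, (2 * (p.eval t - g t) ^ 2 + 2 * (B.indicator (1 : ℝ → ℝ) t - g t) ^ 2) ∂m := by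
          refine integral_mono_of_nonneg (Eventually.of_forall fun t => sq_nonneg _)
            ((i2.const_mul 2).add (i1.const_mul 2)) (Eventually.of_forall fun t => ?_)
          change (p.eval t - B.indicator 1 t) ^ 2 ≤
            2 * (p.eval t - g t) ^ 2 + 2 * (B.indicator (1 : ℝ → ℝ) t - g t) ^ 2
          nlinarith [sq_nonneg ((p.eval t - g t) + (B.indicator (1 : ℝ → ℝ) t - g t))]
      _ = 2 * ∫ t, (p.eval t - g t) ^ 2 ∂m
          + 2 * ∫ t, (B.indicator (1 : ℝ → ℝ) t - g t) ^ 2 ∂m := by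
          rw [integral_add (i2.const_mul 2) (i1.const_mul 2), integral_const_mul,
            integral_const_mul]
      _ < ε := by linarith
  choose p hp using fun n : ℕ => key (1 / (n + 1)) (by positivity)
  refine ⟨p, squeeze_zero (fun n => integral_nonneg fun t => sq_nonneg _) (fun n => (hp n).le) ?_⟩
  exact tendsto_one_div_add_atTop_nhds_zero_nat

/-! ### Scalar spectral measures of self-adjoint operators -/

section ScalarMeasure

variable {H : Type*} [NormedAddCommGroup H] [InnerProductSpace ℝ H]

theorem norm_le_of_forall_abs_inner_le {D : H →L[ℝ] H} (hD : (D : H →ₗ[ℝ] H).IsSymmetric) {ε : ℝ}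
    (hε : 0 ≤ ε) (h : ∀ x, |inner ℝ (D x) x| ≤ ε * ‖x‖ ^ 2) : ‖D‖ ≤ ε := by
  rw [D.norm_eq_iSup_rayleighQuotient hD]
  refine ciSup_le fun x => ?_
  rw [ContinuousLinearMap.rayleighQuotient, abs_div, abs_of_nonneg (sq_nonneg ‖x‖)]
  exact div_le_of_le_mul₀ (sq_nonneg _) hε (h x)

theorem eq_of_forall_inner_self_eq {D D' : H →L[ℝ] H} (hD : (D : H →ₗ[ℝ] H).IsSymmetric)
    (hD' : (D' : H →ₗ[ℝ] H).IsSymmetric) (h : ∀ x, inner ℝ (D x) x = inner ℝ (D' x) x) :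
    D = D' := by
  have hsub : ((D - D' : H →L[ℝ] H) : H →ₗ[ℝ] H).IsSymmetric := hD.sub hD'
  have := norm_le_of_forall_abs_inner_le hsub le_rfl fun x => by
    simp [inner_sub_left, h x]
  exact sub_eq_zero.1 (norm_le_zero_iff.1 this)

theorem inner_pow_apply_eq_sum_eigenvalues [FiniteDimensional ℝ H] {A : H →ₗ[ℝ] H}
    (hA : A.IsSymmetric) {n : ℕ} (hn : Module.finrank ℝ H = n) (j : ℕ) (x : H) :
    inner ℝ ((A ^ j) x) x =
      ∑ i, hA.eigenvalues hn i ^ j * inner ℝ (hA.eigenvectorBasis hn i) x ^ 2 := by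
  have hpow (i : Fin n) : (A ^ j) (hA.eigenvectorBasis hn i) =
      hA.eigenvalues hn i ^ j • hA.eigenvectorBasis hn i := by
    simpa using (hA.hasEigenvector_eigenvectorBasis hn i).pow_apply j
  rw [← (hA.eigenvectorBasis hn).sum_inner_mul_inner]
  refine Finset.sum_congr rfl fun i _ => ?_
  rw [hA.pow j, hpow, inner_smul_right, real_inner_comm]
  simp only [sq]
  ring

theorem abs_eigenvalues_le [FiniteDimensional ℝ H] {A : H →ₗ[ℝ] H}
    (hA : A.IsSymmetric) {n : ℕ} (hn : Module.finrank ℝ H = n) {c : ℝ}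
    (hc : ∀ x, ‖A x‖ ≤ c * ‖x‖) (i : Fin n) :
    hA.eigenvalues hn i ∈ Set.Icc (-c) c := by
  have h := hc (hA.eigenvectorBasis hn i)
  rw [hA.apply_eigenvectorBasis, norm_smul, OrthonormalBasis.norm_eq_one] at h
  rw [Set.mem_Icc, ← abs_le]
  simpa using h

theorem exists_measure_of_finiteDimensional [FiniteDimensional ℝ H] {A : H →ₗ[ℝ] H}
    (hA : A.IsSymmetric) {c : ℝ} (hc : ∀ x, ‖A x‖ ≤ c * ‖x‖) (x : H) :
    ∃ m : Measure ℝ, IsFiniteMeasure m ∧ m (Set.Icc (-c) c)ᶜ = 0 ∧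
      ∀ j : ℕ, ∫ t, t ^ j ∂m = inner ℝ ((A ^ j) x) x := by
  set e := hA.eigenvectorBasis rfl
  set l := hA.eigenvalues rfl
  have hfin (i) : IsFiniteMeasure (ENNReal.ofReal (inner ℝ (e i) x ^ 2) • Measure.dirac (l i)) :=
    Measure.smul_finite _ ENNReal.ofReal_ne_top
  refine ⟨∑ i, ENNReal.ofReal (inner ℝ (e i) x ^ 2) • Measure.dirac (l i), inferInstance, ?_, ?_⟩
  · rw [Measure.finsetSum_apply]
    refine Finset.sum_eq_zero fun i _ => ?_
    rw [Measure.smul_apply, Measure.dirac_apply' _ measurableSet_Icc.compl]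
    simp [Set.indicator, -Set.mem_Icc, abs_eigenvalues_le hA rfl hc i, l]
  · intro j
    rw [inner_pow_apply_eq_sum_eigenvalues hA rfl, integral_finsetSum_measure]
    · refine Finset.sum_congr rfl fun i _ => ?_
      rw [integral_smul_measure, integral_dirac, ENNReal.toReal_ofReal (sq_nonneg _), smul_eq_mul,
        mul_comm]
    · intro i _
      exact (integrable_dirac (by simp)).smul_measure ENNReal.ofReal_ne_top

/-- The moments `⟨T ^ j x, x⟩` of degree at most `d` are those of a measure: compress `T` to the
finite-dimensional span of `x, T x, …, T ^ d x`. -/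
theorem exists_measure_of_moments_le [CompleteSpace H] {T : H →L[ℝ] H} (hT : IsSelfAdjoint T)
    (x : H) (d : ℕ) :
    ∃ m : Measure ℝ, IsFiniteMeasure m ∧ m (Set.Icc (-‖T‖) ‖T‖)ᶜ = 0 ∧
      ∀ j ≤ d, ∫ t, t ^ j ∂m = inner ℝ ((T ^ j) x) x := by
  set W : Submodule ℝ H := Submodule.span ℝ (Set.range fun i : Fin (d + 1) => (T ^ (i : ℕ)) x)
  have hW (j : ℕ) (hj : j ≤ d) : (T ^ j) x ∈ W :=
    Submodule.subset_span ⟨⟨j, Nat.lt_succ_of_le hj⟩, rfl⟩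
  have : FiniteDimensional ℝ W := FiniteDimensional.span_of_finite ℝ (Set.finite_range _)
  set A : W →L[ℝ] W := W.orthogonalProjectionOnto ∘L T ∘L W.subtypeL
  have hAapp (y : W) : A y = W.orthogonalProjectionOnto (T y) := rfl
  have hA : (A : W →ₗ[ℝ] W).IsSymmetric := by
    intro y z
    change inner ℝ (A y) z = inner ℝ y (A z)
    rw [hAapp, hAapp, Submodule.inner_orthogonalProjectionOnto_eq_of_mem_left,
      Submodule.inner_orthogonalProjectionOnto_eq_of_mem_right]
    exact hT.isSymmetric _ _
  have hc (y : W) : ‖(A : W →ₗ[ℝ] W) y‖ ≤ ‖T‖ * ‖y‖ := by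
    change ‖A y‖ ≤ _
    rw [hAapp]
    exact (W.norm_orthogonalProjectionOnto_apply_le _).trans (T.le_opNorm _)
  set x' : W := ⟨x, by simpa using hW 0 (Nat.zero_le d)⟩
  have hpow (j : ℕ) (hj : j ≤ d) : ((((A : W →ₗ[ℝ] W) ^ j) x' : W) : H) = (T ^ j) x := by
    induction j with
    | zero => simp [x']
    | succ j ih =>
      have ih' := ih (by omega)
      rw [pow_succ', pow_succ']
      change ((A (((A : W →ₗ[ℝ] W) ^ j) x') : W) : H) = T ((T ^ j) x)
      rw [hAapp, ih']
      have hmem : T ((T ^ j) x) ∈ W := by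
        have := hW (j + 1) hj
        rwa [pow_succ'] at this
      exact congrArg Subtype.val (Submodule.orthogonalProjectionOnto_mem_subspace_eq_self
        (⟨_, hmem⟩ : W))
  obtain ⟨m, h1, h2, h3⟩ := exists_measure_of_finiteDimensional hA hc x'
  refine ⟨m, h1, h2, fun j hj => ?_⟩
  rw [h3 j, Submodule.coe_inner, hpow j hj]

theorem exists_scalarMeasure [CompleteSpace H] {T : H →L[ℝ] H} (hT : IsSelfAdjoint T) (x : H) :
    ∃ m : Measure ℝ, IsFiniteMeasure m ∧ m (Set.Icc (-‖T‖) ‖T‖)ᶜ = 0 ∧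
      ∀ j : ℕ, ∫ t, t ^ j ∂m = inner ℝ ((T ^ j) x) x := by
  choose m h1 h2 h3 using exists_measure_of_moments_le hT x
  refine exists_measure_of_tendsto_moments (norm_nonneg T) h2 fun j => ?_
  refine tendsto_const_nhds.congr' ?_
  filter_upwards [eventually_ge_atTop j] with d hd
  exact (h3 d j hd).symm

variable [CompleteSpace H]

/-- The scalar spectral measure of the self-adjoint operator `T` at the vector `x`: the measure on
`[-‖T‖, ‖T‖]` with moments `⟨T ^ j x, x⟩`. -/
noncomputable def scalarMeasure {T : H →L[ℝ] H} (hT : IsSelfAdjoint T) (x : H) : Measure ℝ :=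
  (exists_scalarMeasure hT x).choose

section

variable {T : H →L[ℝ] H} (hT : IsSelfAdjoint T)

instance (x : H) : IsFiniteMeasure (scalarMeasure hT x) :=
  (exists_scalarMeasure hT x).choose_spec.1

theorem scalarMeasure_compl (x : H) : scalarMeasure hT x (Set.Icc (-‖T‖) ‖T‖)ᶜ = 0 :=
  (exists_scalarMeasure hT x).choose_spec.2.1

theorem integral_pow_scalarMeasure (x : H) (j : ℕ) :
    ∫ t, t ^ j ∂(scalarMeasure hT x) = inner ℝ ((T ^ j) x) x :=
  (exists_scalarMeasure hT x).choose_spec.2.2 j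

theorem integral_eval_scalarMeasure (x : H) (p : ℝ[X]) :
    ∫ t, p.eval t ∂(scalarMeasure hT x) = inner ℝ (aeval T p x) x := by
  rw [integral_eval_eq_sum (scalarMeasure_compl hT x), aeval_eq_sum_range, sum_apply, sum_inner]
  refine Finset.sum_congr rfl fun i _ => ?_
  rw [integral_pow_scalarMeasure]
  exact (real_inner_smul_left _ _ _).symm

theorem scalarMeasure_univ (x : H) : (scalarMeasure hT x).real Set.univ = ‖x‖ ^ 2 := by
  have := integral_pow_scalarMeasure hT x 0
  simpa using this

theorem inner_aeval_left {T : H →L[ℝ] H} (hT : IsSelfAdjoint T) (p : ℝ[X]) (x y : H) :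
    inner ℝ (aeval T p x) y = inner ℝ x (aeval T p y) := by
  rw [aeval_eq_sum_range, sum_apply, sum_apply, sum_inner, inner_sum]
  refine Finset.sum_congr rfl fun i _ => ?_
  exact ((IsSelfAdjoint.all (p.coeff i)).smul (hT.pow i)).isSymmetric _ _

/-- Hence `p ↦ p(T) x` extends to an isometry from `L²` of the scalar spectral measure at `x`. -/
theorem norm_aeval_apply_sq (p : ℝ[X]) (x : H) :
    ‖aeval T p x‖ ^ 2 = ∫ t, p.eval t ^ 2 ∂(scalarMeasure hT x) := by
  have h := integral_eval_scalarMeasure hT x (p * p)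
  simp only [eval_mul, ← pow_two (eval _ _)] at h
  rw [h, map_mul, mul_apply_eq_comp, inner_aeval_left hT,
    real_inner_self_eq_norm_sq]

end

end ScalarMeasure

/-! ### Existence of the spectral measure of a self-adjoint operator -/

/-- The polynomials `p n` converge to the indicator function of `B` in `L²(m)`. -/
def ApproximatesIndicator (m : Measure ℝ) (B : Set ℝ) (p : ℕ → ℝ[X]) : Prop :=
  Tendsto (fun n => ∫ t, ((p n).eval t - B.indicator 1 t) ^ 2 ∂m) atTop (𝓝 0)

theorem integrable_indicator_one {m : Measure ℝ} [IsFiniteMeasure m] {B : Set ℝ}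
    (hB : MeasurableSet B) : Integrable (B.indicator (1 : ℝ → ℝ)) m :=
  (integrable_const (1 : ℝ)).indicator hB

theorem memLp_eval_sub_indicator {c : ℝ} {m : Measure ℝ} [IsFiniteMeasure m]
    (hm : m (Set.Icc (-c) c)ᶜ = 0) {B : Set ℝ} (hB : MeasurableSet B) (p : ℝ[X]) :
    MemLp (fun t => p.eval t - B.indicator (1 : ℝ → ℝ) t) 2 m := by
  have h1 : MemLp (fun t => p.eval t) 2 m := by
    rw [memLp_two_iff_integrable_sq p.continuous.aestronglyMeasurable]
    exact integrable_of_continuous hm (by fun_prop)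
  exact h1.sub ((memLp_const (1 : ℝ)).indicator hB)

theorem integrable_eval_sub_indicator_sq {c : ℝ} {m : Measure ℝ} [IsFiniteMeasure m]
    (hm : m (Set.Icc (-c) c)ᶜ = 0) {B : Set ℝ} (hB : MeasurableSet B) (p : ℝ[X]) :
    Integrable (fun t => (p.eval t - B.indicator (1 : ℝ → ℝ) t) ^ 2) m :=
  (memLp_eval_sub_indicator hm hB p).integrable_sq

theorem ApproximatesIndicator.mono {c : ℝ} {m m' : Measure ℝ} [IsFiniteMeasure m]
    (hm : m (Set.Icc (-c) c)ᶜ = 0) {B : Set ℝ} (hB : MeasurableSet B) {p : ℕ → ℝ[X]}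
    (h : ApproximatesIndicator m B p) (hle : m' ≤ m) : ApproximatesIndicator m' B p :=
  squeeze_zero (fun _ => integral_nonneg fun _ => sq_nonneg _)
    (fun n => integral_mono_measure hle (Eventually.of_forall fun _ => sq_nonneg _)
      (integrable_eval_sub_indicator_sq hm hB (p n))) h

/-- Convergence in `L²` implies weak convergence, by the Cauchy-Schwarz inequality. -/
theorem ApproximatesIndicator.tendsto_integral_mul_sub {c : ℝ} {m : Measure ℝ} [IsFiniteMeasure m]
    (hm : m (Set.Icc (-c) c)ᶜ = 0) {B : Set ℝ} (hB : MeasurableSet B) {p : ℕ → ℝ[X]}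
    (h : ApproximatesIndicator m B p) {g : ℝ → ℝ} (hg : MemLp g 2 m) :
    Tendsto (fun n => ∫ t, g t * ((p n).eval t - B.indicator 1 t) ∂m) atTop (𝓝 0) := by
  have hb (n : ℕ) : ‖∫ t, g t * ((p n).eval t - B.indicator 1 t) ∂m‖ ≤
      (∫ t, ‖g t‖ ^ (2 : ℝ) ∂m) ^ (1 / (2 : ℝ)) *
        (∫ t, ((p n).eval t - B.indicator 1 t) ^ 2 ∂m) ^ (1 / (2 : ℝ)) := by
    refine (norm_integral_le_integral_norm _).trans ?_
    have h1 := integral_mul_norm_le_Lp_mul_Lq (μ := m) (f := g)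
      (g := fun t => (p n).eval t - B.indicator (1 : ℝ → ℝ) t) Real.HolderConjugate.two_two
      (by simpa using hg) (by simpa using memLp_eval_sub_indicator hm hB (p n))
    refine le_trans (le_of_eq ?_) (h1.trans (le_of_eq ?_))
    · simp_rw [norm_mul]
    · simp
  refine squeeze_zero_norm hb ?_
  have h0 := (h.rpow_const (p := 1 / (2 : ℝ)) (Or.inr (by norm_num))).const_mul
    ((∫ t, ‖g t‖ ^ (2 : ℝ) ∂m) ^ (1 / (2 : ℝ)))
  simpa using h0

theorem ApproximatesIndicator.tendsto_integral {c : ℝ} {m : Measure ℝ} [IsFiniteMeasure m]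
    (hm : m (Set.Icc (-c) c)ᶜ = 0) {B : Set ℝ} (hB : MeasurableSet B) {p : ℕ → ℝ[X]}
    (h : ApproximatesIndicator m B p) :
    Tendsto (fun n => ∫ t, (p n).eval t ∂m) atTop (𝓝 (m.real B)) := by
  have h1 := h.tendsto_integral_mul_sub hm hB (g := fun _ => 1) (memLp_const 1)
  have h2 : Tendsto (fun n => ∫ t, (1 : ℝ) * ((p n).eval t - B.indicator 1 t) ∂m + m.real B)
      atTop (𝓝 (0 + m.real B)) := h1.add_const _
  rw [zero_add] at h2
  refine h2.congr fun n => ?_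
  simp_rw [one_mul]
  rw [integral_sub (integrable_of_continuous hm (p n).continuous) (integrable_indicator_one hB),
    integral_indicator_one hB]
  ring

theorem ApproximatesIndicator.tendsto_integral_pow_mul_sq {c : ℝ} {m : Measure ℝ}
    [IsFiniteMeasure m] (hm : m (Set.Icc (-c) c)ᶜ = 0) {B : Set ℝ} (hB : MeasurableSet B)
    {p : ℕ → ℝ[X]} (h : ApproximatesIndicator m B p) (k : ℕ) :
    Tendsto (fun n => ∫ t, t ^ k * (p n).eval t ^ 2 ∂m) atTop (𝓝 (∫ t in B, t ^ k ∂m)) := by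
  have hk : MemLp (fun t : ℝ => t ^ k) 2 m := by
    rw [memLp_two_iff_integrable_sq (continuous_pow k).aestronglyMeasurable]
    exact integrable_of_continuous hm (by fun_prop)
  have h1 := h.tendsto_integral_mul_sub hm hB (hk.indicator hB)
  have hbound : ∀ᵐ t ∂m, ‖t ^ k‖ ≤ |c| ^ k := by
    filter_upwards [ae_mem_Icc hm] with t ht
    rw [norm_pow]
    gcongr
    exact (abs_le.2 ht).trans (le_abs_self c)
  have hi (n : ℕ) : Integrable (fun t => t ^ k * ((p n).eval t - B.indicator 1 t) ^ 2) m :=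
    (integrable_eval_sub_indicator_sq hm hB (p n)).bdd_mul
      (continuous_pow k).aestronglyMeasurable hbound
  have h2 : Tendsto (fun n => ∫ t, t ^ k * ((p n).eval t - B.indicator 1 t) ^ 2 ∂m)
      atTop (𝓝 0) := by
    have h3 := h.const_mul (|c| ^ k)
    rw [mul_zero] at h3
    refine squeeze_zero_norm (fun n => ?_) h3
    refine (norm_integral_le_integral_norm _).trans ?_
    rw [← integral_const_mul]
    refine integral_mono_ae (hi n).norm
      ((integrable_eval_sub_indicator_sq hm hB (p n)).const_mul _) ?_
    filter_upwards [hbound] with t ht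
    rw [norm_mul, Real.norm_of_nonneg (sq_nonneg _)]
    gcongr
  -- `u ^ 2 = (u - 1_B) ^ 2 + 2 * 1_B * (u - 1_B) + 1_B`
  have h4 := (h2.add (h1.const_mul 2)).add_const (∫ t in B, t ^ k ∂m)
  simp only [mul_zero, zero_add] at h4
  refine h4.congr fun n => ?_
  have i1 : Integrable
      (fun t => B.indicator (fun t => t ^ k) t * ((p n).eval t - B.indicator 1 t)) m :=
    (memLp_eval_sub_indicator hm hB (p n)).integrable_mul (hk.indicator hB) |>.congr
      (Eventually.of_forall fun t => mul_comm _ _)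
  have i2 : Integrable (B.indicator fun t : ℝ => t ^ k) m :=
    (integrable_of_continuous hm (continuous_pow k)).indicator hB
  have i3 : Integrable (fun t => t ^ k * ((p n).eval t - B.indicator 1 t) ^ 2 +
      2 * (B.indicator (fun t => t ^ k) t * ((p n).eval t - B.indicator 1 t))) m :=
    (hi n).add (i1.const_mul 2)
  rw [← integral_indicator hB, ← integral_const_mul, ← integral_add (hi n) (i1.const_mul 2),
    ← integral_add i3 i2]
  refine integral_congr_ae (Eventually.of_forall fun t => ?_)
  by_cases ht : t ∈ B
  · simp only [Set.indicator_of_mem ht, Pi.one_apply]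
    ring
  · simp only [Set.indicator_of_notMem ht]
    ring

section Existence

variable {H : Type*} [NormedAddCommGroup H] [InnerProductSpace ℝ H] [CompleteSpace H]
  {T : H →L[ℝ] H} (hT : IsSelfAdjoint T)

theorem norm_aeval_sub_aeval_sq_le (x : H) {B : Set ℝ} (hB : MeasurableSet B) (p q : ℝ[X]) :
    ‖aeval T p x - aeval T q x‖ ^ 2 ≤
      2 * ∫ t, (p.eval t - B.indicator 1 t) ^ 2 ∂(scalarMeasure hT x) +
      2 * ∫ t, (q.eval t - B.indicator 1 t) ^ 2 ∂(scalarMeasure hT x) := by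
  have e : aeval T p x - aeval T q x = aeval T (p - q) x := by simp
  have i1 := integrable_eval_sub_indicator_sq (scalarMeasure_compl hT x) hB p
  have i2 := integrable_eval_sub_indicator_sq (scalarMeasure_compl hT x) hB q
  rw [e, norm_aeval_apply_sq hT, ← integral_const_mul, ← integral_const_mul,
    ← integral_add (i1.const_mul 2) (i2.const_mul 2)]
  refine integral_mono_of_nonneg (Eventually.of_forall fun t => sq_nonneg _)
    ((i1.const_mul 2).add (i2.const_mul 2)) (Eventually.of_forall fun t => ?_)
  change (p - q).eval t ^ 2 ≤ 2 * (p.eval t - B.indicator 1 t) ^ 2 +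
    2 * (q.eval t - B.indicator (1 : ℝ → ℝ) t) ^ 2
  rw [eval_sub]
  nlinarith [sq_nonneg ((p.eval t - B.indicator (1 : ℝ → ℝ) t) +
    (q.eval t - B.indicator (1 : ℝ → ℝ) t))]

theorem exists_tendsto_aeval (x : H) {B : Set ℝ} (hB : MeasurableSet B) :
    ∃ z : H, ∀ p : ℕ → ℝ[X], ApproximatesIndicator (scalarMeasure hT x) B p →
      Tendsto (fun n => aeval T (p n) x) atTop (𝓝 z) := by
  obtain ⟨q, hq⟩ := exists_polynomial_tendsto_indicator (scalarMeasure_compl hT x) hB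
  have hcau : CauchySeq fun n => aeval T (q n) x := by
    rw [Metric.cauchySeq_iff']
    intro ε hε
    obtain ⟨N, hN⟩ := eventually_atTop.1
      (hq.eventually (gt_mem_nhds (show 0 < ε ^ 2 / 4 by positivity)))
    refine ⟨N, fun n hn => ?_⟩
    have h1 := norm_aeval_sub_aeval_sq_le hT x hB (q n) (q N)
    have h2 := hN n hn
    have h3 := hN N le_rfl
    rw [dist_eq_norm]
    exact lt_of_pow_lt_pow_left₀ 2 hε.le (by linarith)
  obtain ⟨z, hz⟩ := cauchySeq_tendsto_of_complete hcau
  refine ⟨z, fun p hp => ?_⟩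
  have h0 : Tendsto (fun n => ‖aeval T (p n) x - aeval T (q n) x‖ ^ 2) atTop (𝓝 0) := by
    refine squeeze_zero (fun n => sq_nonneg _)
      (fun n => norm_aeval_sub_aeval_sq_le hT x hB (p n) (q n)) ?_
    have := (hp.const_mul 2).add (Tendsto.const_mul 2 hq)
    simpa using this
  have h1 : Tendsto (fun n => aeval T (p n) x - aeval T (q n) x) atTop (𝓝 0) := by
    rw [tendsto_zero_iff_norm_tendsto_zero]
    have := h0.sqrt
    simpa [Real.sqrt_sq (norm_nonneg _)] using this
  simpa using h1.add hz

open Classical in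
/-- The value at `x` of the spectral projection of `T` on the Borel set `B`: the limit of
`p n (T) x` for polynomials `p n` converging to the indicator function of `B`
(and `0` if `B` is not Borel). -/
noncomputable def spectralValue (B : Set ℝ) (x : H) : H :=
  if hB : MeasurableSet B then (exists_tendsto_aeval hT x hB).choose else 0

theorem tendsto_spectralValue {B : Set ℝ} (hB : MeasurableSet B) {x : H} {p : ℕ → ℝ[X]}
    (hp : ApproximatesIndicator (scalarMeasure hT x) B p) :
    Tendsto (fun n => aeval T (p n) x) atTop (𝓝 (spectralValue hT B x)) := by
  rw [spectralValue, dif_pos hB]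
  exact (exists_tendsto_aeval hT x hB).choose_spec p hp

/-- A single sequence of polynomials computes the spectral projection at any three vectors. -/
theorem exists_approximatesIndicator {B : Set ℝ} (hB : MeasurableSet B) (x y z : H) :
    ∃ p : ℕ → ℝ[X], ApproximatesIndicator (scalarMeasure hT x) B p ∧
      ApproximatesIndicator (scalarMeasure hT y) B p ∧
      ApproximatesIndicator (scalarMeasure hT z) B p := by
  have hm : (scalarMeasure hT x + scalarMeasure hT y + scalarMeasure hT z)
      (Set.Icc (-‖T‖) ‖T‖)ᶜ = 0 := by
    simp only [Measure.add_apply, scalarMeasure_compl, add_zero]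
  obtain ⟨p, hp⟩ := exists_polynomial_tendsto_indicator hm hB
  have hp' : ApproximatesIndicator _ B p := hp
  refine ⟨p, hp'.mono hm hB ?_, hp'.mono hm hB ?_, hp'.mono hm hB ?_⟩
  · rw [add_assoc]
    exact Measure.le_add_right le_rfl
  · rw [add_comm (scalarMeasure hT x), add_assoc]
    exact Measure.le_add_right le_rfl
  · exact Measure.le_add_left le_rfl

theorem spectralValue_add (B : Set ℝ) (x y : H) :
    spectralValue hT B (x + y) = spectralValue hT B x + spectralValue hT B y := by
  by_cases hB : MeasurableSet B
  · obtain ⟨p, h1, h2, h3⟩ := exists_approximatesIndicator hT hB x y (x + y)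
    refine tendsto_nhds_unique (tendsto_spectralValue hT hB h3) ?_
    simpa using (tendsto_spectralValue hT hB h1).add (tendsto_spectralValue hT hB h2)
  · simp [spectralValue, hB]

theorem spectralValue_smul (B : Set ℝ) (r : ℝ) (x : H) :
    spectralValue hT B (r • x) = r • spectralValue hT B x := by
  by_cases hB : MeasurableSet B
  · obtain ⟨p, h1, h2, h3⟩ := exists_approximatesIndicator hT hB x x (r • x)
    refine tendsto_nhds_unique (tendsto_spectralValue hT hB h3) ?_
    simpa using (tendsto_spectralValue hT hB h1).const_smul r
  · simp [spectralValue, hB]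

theorem inner_spectralValue_left (B : Set ℝ) (x y : H) :
    inner ℝ (spectralValue hT B x) y = inner ℝ x (spectralValue hT B y) := by
  by_cases hB : MeasurableSet B
  · obtain ⟨p, h1, h2, -⟩ := exists_approximatesIndicator hT hB x y y
    refine tendsto_nhds_unique ((tendsto_spectralValue hT hB h1).inner tendsto_const_nhds) ?_
    refine (Tendsto.inner tendsto_const_nhds (tendsto_spectralValue hT hB h2)).congr fun n => ?_
    exact (inner_aeval_left hT _ _ _).symm
  · simp [spectralValue, hB]

theorem inner_spectralValue_self {B : Set ℝ} (hB : MeasurableSet B) (x : H) :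
    inner ℝ (spectralValue hT B x) x = (scalarMeasure hT x).real B := by
  obtain ⟨p, h1, -, -⟩ := exists_approximatesIndicator hT hB x x x
  refine tendsto_nhds_unique ((tendsto_spectralValue hT hB h1).inner tendsto_const_nhds) ?_
  refine (h1.tendsto_integral (scalarMeasure_compl hT x) hB).congr fun n => ?_
  exact integral_eval_scalarMeasure hT x (p n)

/-- Passing from `x` to its spectral projection on `B` restricts the scalar spectral measure
to `B`. -/
theorem scalarMeasure_spectralValue {B : Set ℝ} (hB : MeasurableSet B) (x : H) :
    scalarMeasure hT (spectralValue hT B x) = (scalarMeasure hT x).restrict B := by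
  refine ext_of_moments (c := ‖T‖) (scalarMeasure_compl hT _) ?_ fun k => ?_
  · exact le_antisymm ((Measure.restrict_apply_le _ _).trans (scalarMeasure_compl hT x).le)
      bot_le
  obtain ⟨p, h1, -, -⟩ := exists_approximatesIndicator hT hB x x x
  rw [integral_pow_scalarMeasure]
  have h2 := tendsto_spectralValue hT hB h1
  refine tendsto_nhds_unique ((((T ^ k).continuous.tendsto _).comp h2).inner h2) ?_
  refine (h1.tendsto_integral_pow_mul_sq (scalarMeasure_compl hT x) hB k).congr fun n => ?_
  have h3 := integral_eval_scalarMeasure hT x (p n * (X ^ k * p n))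
  have e : (fun t => (p n * (X ^ k * p n)).eval t) = fun t => t ^ k * (p n).eval t ^ 2 := by
    funext t
    simp only [eval_mul, eval_pow, eval_X]
    ring
  rw [e] at h3
  rw [h3, map_mul, mul_apply_eq_comp, inner_aeval_left hT, map_mul, mul_apply_eq_comp, map_pow,
    aeval_X]
  rfl

theorem norm_spectralValue_sq {B : Set ℝ} (hB : MeasurableSet B) (x : H) :
    ‖spectralValue hT B x‖ ^ 2 = (scalarMeasure hT x).real B := by
  rw [← scalarMeasure_univ hT, scalarMeasure_spectralValue hT hB, measureReal_restrict_apply_univ]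

theorem norm_spectralValue_le (B : Set ℝ) (x : H) : ‖spectralValue hT B x‖ ≤ ‖x‖ := by
  by_cases hB : MeasurableSet B
  · refine le_of_sq_le_sq ?_ (norm_nonneg x)
    rw [norm_spectralValue_sq hT hB, ← scalarMeasure_univ hT x]
    exact measureReal_mono (Set.subset_univ B)
  · simp [spectralValue, hB]

/-- The spectral projection of `T` on the Borel set `B`. -/
noncomputable def spectralProjection (B : Set ℝ) : H →L[ℝ] H :=
  LinearMap.mkContinuous
    { toFun := spectralValue hT B
      map_add' := spectralValue_add hT B
      map_smul' := spectralValue_smul hT B } 1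
    (fun x => by simpa using norm_spectralValue_le hT B x)

theorem spectralProjection_apply (B : Set ℝ) (x : H) :
    spectralProjection hT B x = spectralValue hT B x := rfl

theorem isSymmetric_spectralProjection (B : Set ℝ) :
    (spectralProjection hT B : H →ₗ[ℝ] H).IsSymmetric :=
  fun x y => inner_spectralValue_left hT B x y

theorem isSelfAdjoint_spectralProjection (B : Set ℝ) :
    IsSelfAdjoint (spectralProjection hT B) :=
  ContinuousLinearMap.isSelfAdjoint_iff_isSymmetric.2 (isSymmetric_spectralProjection hT B)

/-- Both sides are symmetric with quadratic form `x ↦ μ_x (B ∩ C)`, where `μ_x` is the scalar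
spectral measure. -/
theorem spectralProjection_sandwich {B C : Set ℝ} (hB : MeasurableSet B) (hC : MeasurableSet C) :
    spectralProjection hT C * spectralProjection hT B * spectralProjection hT C =
      spectralProjection hT (B ∩ C) := by
  refine eq_of_forall_inner_self_eq ?_ (isSymmetric_spectralProjection hT _) fun x => ?_
  · refine ContinuousLinearMap.isSelfAdjoint_iff_isSymmetric.1 ?_
    rw [IsSelfAdjoint, star_mul, star_mul, (isSelfAdjoint_spectralProjection hT B).star_eq,
      (isSelfAdjoint_spectralProjection hT C).star_eq, mul_assoc]
  · change inner ℝ (spectralValue hT C (spectralValue hT B (spectralValue hT C x))) x =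
      inner ℝ (spectralValue hT (B ∩ C) x) x
    rw [inner_spectralValue_left, inner_spectralValue_self hT hB,
      inner_spectralValue_self hT (hB.inter hC), scalarMeasure_spectralValue hT hC,
      measureReal_restrict_apply hB]

theorem isIdempotentElem_spectralProjection {B : Set ℝ} (hB : MeasurableSet B) :
    spectralProjection hT B * spectralProjection hT B = spectralProjection hT B := by
  refine eq_of_forall_inner_self_eq ?_ (isSymmetric_spectralProjection hT _) fun x => ?_
  · refine ContinuousLinearMap.isSelfAdjoint_iff_isSymmetric.1 ?_
    rw [IsSelfAdjoint, star_mul, (isSelfAdjoint_spectralProjection hT B).star_eq]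
  · change inner ℝ (spectralValue hT B (spectralValue hT B x)) x = inner ℝ (spectralValue hT B x) x
    rw [inner_spectralValue_left, real_inner_self_eq_norm_sq, norm_spectralValue_sq hT hB,
      inner_spectralValue_self hT hB]

theorem spectralProjection_inter {B C : Set ℝ} (hB : MeasurableSet B) (hC : MeasurableSet C) :
    spectralProjection hT (B ∩ C) = spectralProjection hT B * spectralProjection hT C := by
  set P := spectralProjection hT B
  set Q := spectralProjection hT C
  set R := spectralProjection hT (B ∩ C)
  have hP : P * P = P := isIdempotentElem_spectralProjection hT hB
  have hQ : Q * Q = Q := isIdempotentElem_spectralProjection hT hC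
  have hR : R * R = R := isIdempotentElem_spectralProjection hT (hB.inter hC)
  have h1 : Q * P * Q = R := spectralProjection_sandwich hT hB hC
  have h2 : P * Q * P = R := by
    rw [spectralProjection_sandwich hT hC hB, Set.inter_comm]
  have sP : star P = P := isSelfAdjoint_spectralProjection hT B
  have sQ : star Q = Q := isSelfAdjoint_spectralProjection hT C
  have sR : star R = R := isSelfAdjoint_spectralProjection hT (B ∩ C)
  have hPR : P * R = R := by
    rw [← h2, ← mul_assoc, ← mul_assoc, hP]
  have hQR : Q * R = R := by
    rw [← h1, ← mul_assoc, ← mul_assoc, hQ]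
  have hRP : R * P = R := by
    rw [← h2, mul_assoc, hP]
  -- `P * Q - R` vanishes because `star (P * Q - R) * (P * Q - R)` does
  have h0 : star (P * Q - R) * (P * Q - R) = 0 := by
    rw [star_sub, star_mul, sP, sQ, sR, sub_mul, mul_sub, mul_sub, hR]
    have e1 : Q * P * (P * Q) = R := by
      rw [← mul_assoc, mul_assoc Q P P, hP, h1]
    have e2 : Q * P * R = R := by rw [mul_assoc, hPR, hQR]
    have e3 : R * (P * Q) = R := by
      have : R * Q = R := by rw [← h1, mul_assoc, hQ]
      rw [← mul_assoc, hRP, this]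
    rw [e1, e2, e3]
    simp
  exact (sub_eq_zero.1 ((CStarRing.star_mul_self_eq_zero_iff _).1 h0)).symm

theorem hasSum_spectralProjection {B : ℕ → Set ℝ} (hB : ∀ i, MeasurableSet (B i))
    (hd : Pairwise (Function.onFun Disjoint B)) (x : H) :
    HasSum (fun i => spectralProjection hT (B i) x) (spectralProjection hT (⋃ i, B i) x) := by
  have hU : MeasurableSet (⋃ i, B i) := MeasurableSet.iUnion hB
  set m := scalarMeasure hT x
  have hsum : HasSum (fun i => m.real (B i)) (m.real (⋃ i, B i)) := by
    have h1 : m (⋃ i, B i) = ∑' i, m (B i) := measure_iUnion hd hB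
    have hne : ∑' i, m (B i) ≠ ∞ := by rw [← h1]; exact measure_ne_top _ _
    rw [measureReal_def, h1, ENNReal.tsum_toReal_eq fun i => measure_ne_top _ _]
    exact (ENNReal.summable_toReal hne).hasSum
  -- orthogonality of the projections reduces the convergence of the vectors to that of measures
  have key (F : Finset ℕ) :
      ‖spectralProjection hT (⋃ i, B i) x - ∑ i ∈ F, spectralProjection hT (B i) x‖ ^ 2 =
        m.real (⋃ i, B i) - ∑ i ∈ F, m.real (B i) := by
    have hdisj (i j : ℕ) : inner ℝ (spectralProjection hT (B i) x)
        (spectralProjection hT (B j) x) = if i = j then m.real (B i) else 0 := by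
      change inner ℝ (spectralValue hT (B i) x) (spectralProjection hT (B j) x) = _
      rw [inner_spectralValue_left, ← spectralProjection_apply, ← mul_apply_eq_comp,
        ← spectralProjection_inter hT (hB i) (hB j), real_inner_comm, spectralProjection_apply,
        inner_spectralValue_self hT ((hB i).inter (hB j))]
      split_ifs with h
      · rw [h, Set.inter_self]
      · rw [(hd h).inter_eq, measureReal_empty]
    have hcross (j : ℕ) : inner ℝ (spectralProjection hT (⋃ i, B i) x)
        (spectralProjection hT (B j) x) = m.real (B j) := by
      change inner ℝ (spectralValue hT _ x) (spectralProjection hT (B j) x) = _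
      rw [inner_spectralValue_left, ← spectralProjection_apply, ← mul_apply_eq_comp,
        ← spectralProjection_inter hT hU (hB j), real_inner_comm, spectralProjection_apply,
        inner_spectralValue_self hT (hU.inter (hB j)),
        Set.inter_eq_self_of_subset_right (Set.subset_iUnion B j)]
    rw [norm_sub_sq_real, inner_sum, ← real_inner_self_eq_norm_sq (∑ i ∈ F, _), sum_inner]
    simp_rw [inner_sum, hdisj, hcross]
    rw [spectralProjection_apply, norm_spectralValue_sq hT hU]
    simp only [Finset.sum_ite_eq, Finset.sum_ite_mem, Finset.inter_self]
    ring
  have h0 : Tendsto (fun F : Finset ℕ => ‖spectralProjection hT (⋃ i, B i) x -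
      ∑ i ∈ F, spectralProjection hT (B i) x‖ ^ 2) atTop (𝓝 0) := by
    simp_rw [key]
    simpa using (tendsto_const_nhds (x := m.real (⋃ i, B i))).sub hsum
  have h1 : Tendsto (fun F : Finset ℕ => ‖∑ i ∈ F, spectralProjection hT (B i) x -
      spectralProjection hT (⋃ i, B i) x‖) atTop (𝓝 0) := by
    have := h0.sqrt
    simpa [Real.sqrt_sq (norm_nonneg _), norm_sub_rev] using this
  exact tendsto_iff_norm_sub_tendsto_zero.2 h1

theorem spectralProjection_eq_one {B : Set ℝ} (hB : MeasurableSet B)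
    (h : ∀ x, (scalarMeasure hT x).real B = ‖x‖ ^ 2) : spectralProjection hT B = 1 := by
  refine eq_of_forall_inner_self_eq (isSymmetric_spectralProjection hT _) (fun _ _ => rfl)
    fun x => ?_
  rw [spectralProjection_apply, inner_spectralValue_self hT hB, h]
  simp

/-- The spectral projections of `T` form a projection-valued measure. -/
noncomputable def spectralMeasure : ProjectionValuedMeasure H where
  toFun := spectralProjection hT
  isStarProjection _ hB :=
    ⟨isIdempotentElem_spectralProjection hT hB, isSelfAdjoint_spectralProjection hT _⟩
  univ := spectralProjection_eq_one hT MeasurableSet.univ (scalarMeasure_univ hT)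
  inter _ _ hB hC := spectralProjection_inter hT hB hC
  hasSum_iUnion _ hB hd x := hasSum_spectralProjection hT hB hd x

theorem measure_spectralMeasure (x : H) : (spectralMeasure hT).measure x = scalarMeasure hT x := by
  ext B hB
  rw [ProjectionValuedMeasure.measure_apply _ x hB]
  change ENNReal.ofReal (inner ℝ (spectralValue hT B x) x) = _
  rw [inner_spectralValue_self hT hB, ofReal_measureReal]

theorem isSpectralMeasureOf_spectralMeasure : (spectralMeasure hT).IsSpectralMeasureOf T where
  isSelfAdjoint := hT
  carried := by
    refine spectralProjection_eq_one hT measurableSet_Icc fun x => ?_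
    rw [← scalarMeasure_univ hT x, ← measureReal_restrict_apply_univ,
      restrict_Icc_eq (scalarMeasure_compl hT x)]
  integral x := by
    rw [measure_spectralMeasure]
    simpa using (integral_pow_scalarMeasure hT x 1).symm

end Existence

/-! ### Uniqueness of the scalar spectral measures -/

namespace ProjectionValuedMeasure

variable {H : Type*} [NormedAddCommGroup H] [InnerProductSpace ℝ H] [CompleteSpace H]
  (E : ProjectionValuedMeasure H)

theorem measureReal_apply (x : H) {B : Set ℝ} (hB : MeasurableSet B) :
    (E.measure x).real B = inner ℝ (E.toFun B x) x := by
  rw [measureReal_def, E.measure_apply x hB, ENNReal.toReal_ofReal (E.inner_nonneg x hB)]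

theorem measureReal_univ (x : H) : (E.measure x).real Set.univ = ‖x‖ ^ 2 := by
  rw [E.measureReal_apply x MeasurableSet.univ, E.univ]
  simp

instance (x : H) : IsFiniteMeasure (E.measure x) :=
  ⟨by rw [E.measure_apply x MeasurableSet.univ]; exact ENNReal.ofReal_lt_top⟩

theorem isSymmetric {B : Set ℝ} (hB : MeasurableSet B) :
    (E.toFun B : H →ₗ[ℝ] H).IsSymmetric :=
  (E.isStarProjection B hB).isSelfAdjoint.isSymmetric

theorem measure_compl_Icc {T : H →L[ℝ] H} (hE : E.IsSpectralMeasureOf T) (x : H) :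
    E.measure x (Set.Icc (-‖T‖) ‖T‖)ᶜ = 0 := by
  rw [measure_compl measurableSet_Icc (measure_ne_top _ _), E.measure_apply x MeasurableSet.univ,
    E.measure_apply x measurableSet_Icc, hE.carried, E.univ, tsub_self]

/-- The set of the points `t` with `⌊N t⌋ = j`: for `N > 0`, the interval
`[j / N, (j + 1) / N)`. -/
def floorCell (N : ℕ) (j : ℤ) : Set ℝ := {t : ℝ | ⌊(N : ℝ) * t⌋ = j}

theorem measurable_floor_mul (N : ℕ) : Measurable fun t : ℝ => ⌊(N : ℝ) * t⌋ :=
  Int.measurable_floor.comp (measurable_const.mul measurable_id)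

theorem measurableSet_floorCell (N : ℕ) (j : ℤ) : MeasurableSet (floorCell N j) :=
  measurable_floor_mul N (measurableSet_singleton j)

/-- The Riemann sum of `∫ t ^ n dE` for the partition of `[-c, c]` into intervals of length
`1 / N`, with the left endpoints as sample points. -/
noncomputable def riemannSum (c : ℝ) (N n : ℕ) : H →L[ℝ] H :=
  ∑ j ∈ Finset.Icc (-⌈(N : ℝ) * c⌉) ⌈(N : ℝ) * c⌉, ((j : ℝ) / N) ^ n • E.toFun (floorCell N j)

theorem isSymmetric_riemannSum (c : ℝ) (N n : ℕ) :
    (E.riemannSum c N n : H →ₗ[ℝ] H).IsSymmetric := by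
  refine ContinuousLinearMap.isSelfAdjoint_iff_isSymmetric.1 (isSelfAdjoint_sum _ fun j _ => ?_)
  exact (IsSelfAdjoint.all _).smul
    (E.isStarProjection _ (measurableSet_floorCell N j)).isSelfAdjoint

theorem riemannSum_mul (c : ℝ) (N a b : ℕ) :
    E.riemannSum c N a * E.riemannSum c N b = E.riemannSum c N (a + b) := by
  have h0 : E.toFun ∅ = 0 := by ext x; exact E.apply_empty x
  have hprod (i j : ℤ) : E.toFun (floorCell N i) * E.toFun (floorCell N j) =
      if i = j then E.toFun (floorCell N i) else 0 := by
    rw [← E.inter _ _ (measurableSet_floorCell N i) (measurableSet_floorCell N j)]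
    split_ifs with h
    · rw [h, Set.inter_self]
    · rw [← h0]
      congr 1
      ext t
      simp only [floorCell, Set.mem_inter_iff, Set.mem_ofPred_eq, Set.mem_empty_iff_false,
        iff_false, not_and]
      exact fun h1 h2 => h (h1.symm.trans h2)
  simp only [riemannSum, Finset.sum_mul, Finset.mul_sum, smul_mul_smul_comm, hprod]
  refine Finset.sum_congr rfl fun i hi => ?_
  simp only [smul_ite, smul_zero]
  rw [Finset.sum_ite_eq', if_pos hi, pow_add]

theorem inner_riemannSum {c : ℝ} {N : ℕ} (x : H)
    (hx : E.measure x (Set.Icc (-c) c)ᶜ = 0) (n : ℕ) :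
    inner ℝ (E.riemannSum c N n x) x =
      ∫ t, ((⌊(N : ℝ) * t⌋ : ℝ) / N) ^ n ∂(E.measure x) := by
  set J := Finset.Icc (-⌈(N : ℝ) * c⌉) ⌈(N : ℝ) * c⌉ with hJ
  have h1 : ∫ t, ((⌊(N : ℝ) * t⌋ : ℝ) / N) ^ n ∂(E.measure x) =
      ∫ t, ∑ j ∈ J, (floorCell N j).indicator (fun _ => ((j : ℝ) / N) ^ n) t ∂(E.measure x) := by
    refine integral_congr_ae ?_
    filter_upwards [ae_mem_Icc hx] with t ht
    have hN : (0 : ℝ) ≤ N := N.cast_nonneg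
    have hmem : ⌊(N : ℝ) * t⌋ ∈ J := by
      have hu : (N : ℝ) * t ≤ N * c := mul_le_mul_of_nonneg_left ht.2 hN
      have hl : -((N : ℝ) * c) ≤ N * t := by
        rw [← mul_neg]
        exact mul_le_mul_of_nonneg_left ht.1 hN
      have hce := Int.le_ceil ((N : ℝ) * c)
      rw [hJ, Finset.mem_Icc]
      constructor
      · rw [Int.le_floor]
        push_cast
        linarith
      · exact Int.cast_le.1 ((Int.floor_le _).trans (hu.trans hce))
    rw [Finset.sum_eq_single_of_mem _ hmem]
    · rw [Set.indicator_of_mem (show t ∈ floorCell N ⌊(N : ℝ) * t⌋ from Eq.refl ⌊(N : ℝ) * t⌋)]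
    · intro j _ hj
      exact Set.indicator_of_notMem (s := floorCell N j) (a := t)
        (fun h : ⌊(N : ℝ) * t⌋ = j => hj h.symm) _
  rw [h1, integral_finsetSum]
  · rw [riemannSum, sum_apply, sum_inner]
    refine Finset.sum_congr rfl fun j _ => ?_
    rw [integral_indicator_const _ (measurableSet_floorCell N j),
      E.measureReal_apply x (measurableSet_floorCell N j), smul_eq_mul, mul_comm]
    exact real_inner_smul_left _ _ _
  · exact fun j _ => (integrable_const _).indicator (measurableSet_floorCell N j)

theorem abs_sub_floor_div_le {N : ℕ} (hN : 0 < N) (t : ℝ) :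
    |t - (⌊(N : ℝ) * t⌋ : ℝ) / N| ≤ 1 / N := by
  have hN' : (0 : ℝ) < N := Nat.cast_pos.2 hN
  have h1 := Int.floor_le ((N : ℝ) * t)
  have h2 := Int.lt_floor_add_one ((N : ℝ) * t)
  have e : t - (⌊(N : ℝ) * t⌋ : ℝ) / N = (N * t - ⌊(N : ℝ) * t⌋) / N := by field_simp
  rw [e, abs_of_nonneg (div_nonneg (by linarith) hN'.le)]
  gcongr
  linarith

theorem tendsto_floor_div (t : ℝ) :
    Tendsto (fun N : ℕ => (⌊(N : ℝ) * t⌋ : ℝ) / N) atTop (𝓝 t) := by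
  rw [tendsto_iff_norm_sub_tendsto_zero]
  refine squeeze_zero' (Eventually.of_forall fun _ => norm_nonneg _) ?_
    tendsto_one_div_atTop_nhds_zero_nat
  filter_upwards [eventually_gt_atTop 0] with N hN
  rw [norm_sub_rev]
  exact abs_sub_floor_div_le hN t

theorem norm_floor_div_le {c : ℝ} {t : ℝ} (ht : t ∈ Set.Icc (-c) c) {N : ℕ} (hN : 0 < N) :
    ‖(⌊(N : ℝ) * t⌋ : ℝ) / N‖ ≤ c + 1 := by
  have h1 := abs_sub_floor_div_le hN t
  have h2 : (1 : ℝ) / N ≤ 1 := by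
    rw [div_le_one (Nat.cast_pos.2 hN)]
    exact_mod_cast hN
  rw [abs_le] at h1
  rw [Real.norm_eq_abs, abs_le]
  constructor <;> linarith [ht.1, ht.2]

theorem integrable_floor_div_pow {c : ℝ} {m : Measure ℝ} [IsFiniteMeasure m]
    (hm : m (Set.Icc (-c) c)ᶜ = 0) {N : ℕ} (hN : 0 < N) (n : ℕ) :
    Integrable (fun t => ((⌊(N : ℝ) * t⌋ : ℝ) / N) ^ n) m := by
  refine Integrable.of_bound (C := (c + 1) ^ n) ?_ ?_
  · exact (((measurable_from_top.comp (measurable_floor_mul N)).div_const _).pow_const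
      n).aestronglyMeasurable
  · filter_upwards [ae_mem_Icc hm] with t ht
    rw [norm_pow]
    gcongr
    exact norm_floor_div_le ht hN

/-- The moments of the measures `B ↦ ⟨E(B) x, x⟩` are determined by `T`: the Riemann sums of
`∫ t dE` converge to `T` in norm, and their powers are the Riemann sums of `∫ t ^ n dE`. -/
theorem integral_pow_measure {T : H →L[ℝ] H} (hE : E.IsSpectralMeasureOf T) (x : H) (n : ℕ) :
    ∫ t, t ^ n ∂(E.measure x) = inner ℝ ((T ^ n) x) x := by
  have hc := E.measure_compl_Icc hE
  have hnorm (N : ℕ) (hN : 0 < N) : ‖E.riemannSum ‖T‖ N 1 - T‖ ≤ 1 / N := by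
    rw [norm_sub_rev]
    refine norm_le_of_forall_abs_inner_le
      (hE.isSelfAdjoint.isSymmetric.sub (E.isSymmetric_riemannSum _ _ _)) (by positivity)
      fun y => ?_
    rw [sub_apply, inner_sub_left, E.inner_riemannSum y (hc y), hE.integral y,
      ← integral_sub (integrable_of_continuous (hc y) continuous_id')
        (integrable_floor_div_pow (hc y) hN 1), ← E.measureReal_univ y]
    have h : ∀ᵐ t ∂(E.measure y), ‖t - ((⌊(N : ℝ) * t⌋ : ℝ) / N) ^ 1‖ ≤ 1 / N :=
      Eventually.of_forall fun t => by rw [pow_one]; exact abs_sub_floor_div_le hN t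
    exact norm_integral_le_of_norm_le_const h
  have hlim : Tendsto (fun N => E.riemannSum ‖T‖ N 1) atTop (𝓝 T) := by
    rw [tendsto_iff_norm_sub_tendsto_zero]
    refine squeeze_zero' (Eventually.of_forall fun _ => norm_nonneg _) ?_
      tendsto_one_div_atTop_nhds_zero_nat
    filter_upwards [eventually_gt_atTop 0] with N hN using hnorm N hN
  have hpow (N : ℕ) : E.riemannSum ‖T‖ N 1 ^ n = E.riemannSum ‖T‖ N n := by
    induction n with
    | zero =>
      rw [pow_zero]
      refine eq_of_forall_inner_self_eq (fun _ _ => rfl) (E.isSymmetric_riemannSum _ _ _)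
        fun y => ?_
      rw [E.inner_riemannSum y (hc y)]
      simp [E.measureReal_univ]
    | succ n ih => rw [pow_succ, ih, riemannSum_mul]
  have h1 : Tendsto (fun N => inner ℝ ((E.riemannSum ‖T‖ N 1 ^ n) x) x) atTop
      (𝓝 (inner ℝ ((T ^ n) x) x)) :=
    ((ContinuousLinearMap.apply ℝ H x).continuous.tendsto _ |>.comp (hlim.pow n)).inner
      tendsto_const_nhds
  have h2 : Tendsto (fun N : ℕ => ∫ t, ((⌊(N : ℝ) * t⌋ : ℝ) / N) ^ n ∂(E.measure x)) atTop
      (𝓝 (∫ t, t ^ n ∂(E.measure x))) := by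
    refine tendsto_integral_filter_of_dominated_convergence (fun _ => (‖T‖ + 1) ^ n) ?_ ?_
      (integrable_const _) (Eventually.of_forall fun t => (tendsto_floor_div t).pow n)
    · filter_upwards [eventually_gt_atTop 0] with N hN
      exact (integrable_floor_div_pow (hc x) hN n).aestronglyMeasurable
    · filter_upwards [eventually_gt_atTop 0] with N hN
      filter_upwards [ae_mem_Icc (hc x)] with t ht
      rw [norm_pow]
      gcongr
      exact norm_floor_div_le ht hN
  refine tendsto_nhds_unique h2 (h1.congr fun N => ?_)
  rw [hpow, E.inner_riemannSum x (hc x)]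

theorem measure_eq_scalarMeasure {T : H →L[ℝ] H} (hE : E.IsSpectralMeasureOf T) (x : H) :
    E.measure x = scalarMeasure hE.isSelfAdjoint x :=
  ext_of_moments (E.measure_compl_Icc hE x) (scalarMeasure_compl _ x) fun n => by
    rw [E.integral_pow_measure hE, integral_pow_scalarMeasure]

end ProjectionValuedMeasure

/-! ### Markov operators and their moments -/

section Markov

variable {Γ : Type*} [Group Γ]

theorem inner_compPerm_left {V : Type*} (σ : Equiv.Perm V) (f g : L2 V) :
    inner ℝ (compPerm σ f) g = inner ℝ f (compPerm σ⁻¹ g) := by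
  rw [lp.inner_eq_tsum, lp.inner_eq_tsum,
    ← σ.tsum_eq fun v => inner ℝ (f v) (compPerm σ⁻¹ g v)]
  refine tsum_congr fun v => ?_
  change inner ℝ (f (σ v)) (g v) = inner ℝ (f (σ v)) (g (σ⁻¹ (σ v)))
  simp

theorem isSelfAdjoint_markov {S : Finset Γ} (hsymm : ∀ s ∈ S, s⁻¹ ∈ S) (P : Subgroup Γ) :
    IsSelfAdjoint (markov S P) := by
  refine IsSelfAdjoint.smul (IsSelfAdjoint.all _)
    (ContinuousLinearMap.isSelfAdjoint_iff_isSymmetric.2 fun f g => ?_)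
  change inner ℝ ((∑ s ∈ S, (compPerm (MulAction.toPerm s)).toContinuousLinearMap) f) g =
    inner ℝ f ((∑ s ∈ S, (compPerm (MulAction.toPerm s)).toContinuousLinearMap) g)
  rw [sum_apply, sum_apply, sum_inner, inner_sum]
  refine Finset.sum_nbij' (·⁻¹) (·⁻¹) hsymm hsymm (fun s _ => inv_inv s) (fun s _ => inv_inv s)
    fun s _ => ?_
  change inner ℝ (compPerm (MulAction.toPerm s) f) g =
    inner ℝ f (compPerm (MulAction.toPerm s⁻¹) g)
  rw [inner_compPerm_left]
  rfl

theorem norm_markov_le (S : Finset Γ) (P : Subgroup Γ) : ‖markov S P‖ ≤ 1 := by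
  rw [markov, norm_smul]
  have h1 : ‖∑ s ∈ S, (compPerm (V := Γ ⧸ P) (MulAction.toPerm s)).toContinuousLinearMap‖ ≤
      S.card := by
    refine (norm_sum_le_of_le S fun s _ => LinearIsometry.norm_toContinuousLinearMap_le _).trans ?_
    simp
  rw [Real.norm_of_nonneg (by positivity), one_div_mul_eq_div]
  exact div_le_one_of_le₀ h1 (by positivity)

/-- The element of `Γ` represented by a word of length `n` in the generators. -/
def wordProd {S : Finset Γ} {n : ℕ} (σ : Fin n → S) : Γ :=
  (List.ofFn fun i => (σ i : Γ)).prod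

theorem wordProd_cons {S : Finset Γ} {n : ℕ} (s : S) (σ : Fin n → S) :
    wordProd (Fin.cons s σ : Fin (n + 1) → S) = s * wordProd σ := by
  simp [wordProd, List.ofFn_succ]

theorem exists_wordProd_eq {S : Finset Γ} (hsymm : ∀ s ∈ S, s⁻¹ ∈ S)
    (hgen : Subgroup.closure (S : Set Γ) = ⊤) (g : Γ) :
    ∃ (n : ℕ) (σ : Fin n → S), wordProd σ = g := by
  have hSinv : (S : Set Γ) ∪ (S : Set Γ)⁻¹ = S :=
    Set.union_eq_self_of_subset_right fun s hs => by
      simpa using hsymm _ (Set.mem_inv.1 hs)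
  have hg : g ∈ Submonoid.closure (S : Set Γ) := by
    rw [← hSinv, ← Subgroup.closure_toSubmonoid, hgen]
    trivial
  obtain ⟨l, hl, rfl⟩ := Submonoid.exists_list_of_mem_closure hg
  exact ⟨l.length, fun i => ⟨l.get i, hl _ (l.get_mem i)⟩, by simp [wordProd]⟩

theorem markov_pow_apply (S : Finset Γ) (P : Subgroup Γ) (n : ℕ) (f : L2 (Γ ⧸ P)) (v : Γ ⧸ P) :
    (markov S P ^ n) f v =
      (1 / (S.card : ℝ)) ^ n * ∑ σ : Fin n → S, f (wordProd σ • v) := by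
  induction n generalizing f with
  | zero => simp [wordProd]
  | succ n ih =>
    rw [pow_succ, mul_apply_eq_comp, ih, ← (Fin.consEquiv fun _ => S).sum_comp,
      Fintype.sum_prod_type_right, pow_succ, mul_assoc, Finset.mul_sum (a := 1 / (S.card : ℝ))]
    congr 1
    refine Finset.sum_congr rfl fun σ _ => ?_
    rw [markov_apply, ← Finset.sum_coe_sort]
    congr 1
    refine Finset.sum_congr rfl fun s _ => ?_
    change f ((s : Γ) • wordProd σ • v) = f (wordProd (Fin.cons s σ : Fin (n + 1) → S) • v)
    rw [wordProd_cons, mul_smul]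

open Classical in
theorem inner_markov_pow_single (S : Finset Γ) (P : Subgroup Γ) (n : ℕ) (v : Γ ⧸ P) :
    inner ℝ ((markov S P ^ n) (lp.single 2 v (1 : ℝ))) (lp.single 2 v (1 : ℝ)) =
      (1 / (S.card : ℝ)) ^ n *
        ∑ σ : Fin n → S, if wordProd σ • v = v then (1 : ℝ) else 0 := by
  rw [lp.inner_single_right, markov_pow_apply]
  simp [Pi.single_apply]

section FiniteIndex

variable (S : Finset Γ) (Q : Subgroup Γ)

/-- The orthonormal basis of point masses of `ℓ²` of a finite set. -/
noncomputable def pointBasis (V : Type*) [Fintype V] : OrthonormalBasis V ℝ (L2 V) :=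
  (HilbertBasis.ofRepr (LinearIsometryEquiv.refl ℝ (L2 V))).toOrthonormalBasis

open Classical in
theorem pointBasis_apply {V : Type*} [Fintype V] (v : V) :
    pointBasis V v = lp.single 2 v (1 : ℝ) := by
  rw [pointBasis, HilbertBasis.coe_toOrthonormalBasis, ← HilbertBasis.repr_symm_single]
  rfl

instance {V : Type*} [Finite V] : FiniteDimensional ℝ (L2 V) := by
  have := Fintype.ofFinite V
  exact (pointBasis V).toBasis.finiteDimensional_of_finite

theorem finrank_L2 (V : Type*) [Finite V] : Module.finrank ℝ (L2 V) = Nat.card V := by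
  have := Fintype.ofFinite V
  rw [Module.finrank_eq_card_basis (pointBasis V).toBasis, Nat.card_eq_fintype_card]

variable {S Q} [Finite (Γ ⧸ Q)] (hM : (markov S Q : L2 (Γ ⧸ Q) →ₗ[ℝ] L2 (Γ ⧸ Q)).IsSymmetric)

theorem eigenvalueMeasure_eq_sum : eigenvalueMeasure S Q =
    ∑ i, (Nat.card (Γ ⧸ Q) : ℝ≥0∞)⁻¹ • Measure.dirac (hM.eigenvalues (finrank_L2 _) i) := by
  classical
  set l := hM.eigenvalues (finrank_L2 _) with hl
  ext B hB
  rw [eigenvalueMeasure, Measure.sum_apply _ hB, Measure.finsetSum_apply]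
  have h (t : ℝ) : (((Module.finrank ℝ (Module.End.eigenspace
      (markov S Q : L2 (Γ ⧸ Q) →ₗ[ℝ] L2 (Γ ⧸ Q)) t) : ℝ≥0∞) / (Nat.card (Γ ⧸ Q) : ℝ≥0∞)) •
        Measure.dirac t) B =
      ∑ i, if t = l i then (Nat.card (Γ ⧸ Q) : ℝ≥0∞)⁻¹ * Measure.dirac t B else 0 := by
    have hcard := hM.card_filter_eigenvalues_eq (finrank_L2 _) t
    rw [← Finset.sum_filter, Finset.sum_const, Measure.smul_apply, smul_eq_mul, nsmul_eq_mul,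
      div_eq_mul_inv, mul_assoc]
    congr 2
    refine hcard.symm.trans ?_
    congr 1
    ext i
    simp [hl, eq_comm]
  simp_rw [h]
  rw [Summable.tsum_finsetSum fun _ _ => ENNReal.summable]
  refine Finset.sum_congr rfl fun i _ => ?_
  rw [tsum_ite_eq]
  rfl

theorem isFiniteMeasure_eigenvalueMeasure
    (hM : (markov S Q : L2 (Γ ⧸ Q) →ₗ[ℝ] L2 (Γ ⧸ Q)).IsSymmetric) :
    IsFiniteMeasure (eigenvalueMeasure S Q) := by
  rw [eigenvalueMeasure_eq_sum hM]
  have hfin (i) : IsFiniteMeasure ((Nat.card (Γ ⧸ Q) : ℝ≥0∞)⁻¹ •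
      Measure.dirac (hM.eigenvalues (finrank_L2 _) i)) :=
    Measure.smul_finite _ (by simp [Nat.card_pos.ne'])
  infer_instance

theorem eigenvalueMeasure_compl
    (hM : (markov S Q : L2 (Γ ⧸ Q) →ₗ[ℝ] L2 (Γ ⧸ Q)).IsSymmetric) :
    eigenvalueMeasure S Q (Set.Icc (-1) 1)ᶜ = 0 := by
  rw [eigenvalueMeasure_eq_sum hM, Measure.finsetSum_apply]
  refine Finset.sum_eq_zero fun i _ => ?_
  have hi := abs_eigenvalues_le hM (finrank_L2 _) (c := 1)
    (fun x => (markov S Q).le_of_opNorm_le (norm_markov_le S Q) x) i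
  rw [Measure.smul_apply, Measure.dirac_apply' _ measurableSet_Icc.compl]
  simp [Set.indicator, -Set.mem_Icc, hi]

/-- The `n`-th moment of the eigenvalue counting measure is a normalized trace, hence an average of
numbers of fixed points. -/
theorem integral_pow_eigenvalueMeasure
    (hM : (markov S Q : L2 (Γ ⧸ Q) →ₗ[ℝ] L2 (Γ ⧸ Q)).IsSymmetric) (n : ℕ) :
    ∫ t, t ^ n ∂(eigenvalueMeasure S Q) = (1 / (S.card : ℝ)) ^ n *
      ∑ σ : Fin n → S, (Nat.card {v : Γ ⧸ Q // wordProd σ • v = v} : ℝ) / Nat.card (Γ ⧸ Q) := by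
  classical
  have := Fintype.ofFinite (Γ ⧸ Q)
  set l := hM.eigenvalues (finrank_L2 _)
  have htr : ∑ i, l i ^ n = ∑ v : Γ ⧸ Q, (1 / (S.card : ℝ)) ^ n *
      ∑ σ : Fin n → S, if wordProd σ • v = v then (1 : ℝ) else 0 := by
    have h1 := LinearMap.trace_eq_sum_inner ((markov S Q : L2 (Γ ⧸ Q) →ₗ[ℝ] L2 (Γ ⧸ Q)) ^ n)
      (hM.eigenvectorBasis (finrank_L2 _))
    have h2 := LinearMap.trace_eq_sum_inner ((markov S Q : L2 (Γ ⧸ Q) →ₗ[ℝ] L2 (Γ ⧸ Q)) ^ n)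
      (pointBasis (Γ ⧸ Q))
    rw [h1] at h2
    refine Eq.trans ?_ (h2.trans ?_)
    · refine Finset.sum_congr rfl fun i _ => ?_
      rw [(hM.hasEigenvector_eigenvectorBasis _ i).pow_apply n, inner_smul_right,
        real_inner_self_eq_norm_sq, OrthonormalBasis.norm_eq_one]
      simp [l]
    · refine Finset.sum_congr rfl fun v _ => ?_
      rw [pointBasis_apply, real_inner_comm, ← inner_markov_pow_single,
        ← ContinuousLinearMap.toLinearMap_pow, ContinuousLinearMap.coe_coe]
      congr!
  have hint : ∫ t, t ^ n ∂(eigenvalueMeasure S Q) = (Nat.card (Γ ⧸ Q) : ℝ)⁻¹ * ∑ i, l i ^ n := by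
    rw [eigenvalueMeasure_eq_sum hM, integral_finsetSum_measure, Finset.mul_sum]
    · refine Finset.sum_congr rfl fun i _ => ?_
      rw [integral_smul_measure, integral_dirac]
      simp [l]
    · intro i _
      exact (integrable_dirac (by simp)).smul_measure (by simp)
  rw [hint, htr, ← Finset.mul_sum, Finset.sum_comm, mul_left_comm, Finset.mul_sum]
  congr 1
  refine Finset.sum_congr rfl fun σ _ => ?_
  rw [Finset.sum_boole, Nat.card_eq_fintype_card (α := {v : Γ ⧸ Q // wordProd σ • v = v}),
    Fintype.card_subtype, div_eq_inv_mul]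

end FiniteIndex

/-- The moments of the Kesten spectral measure of the Cayley graph are return probabilities. -/
theorem integral_pow_of_isCayleyKestenMeasure {S : Finset Γ} {ν : Measure ℝ}
    (hν : IsCayleyKestenMeasure S ν) :
    IsFiniteMeasure ν ∧ ν (Set.Icc (-1) 1)ᶜ = 0 ∧ ∀ n : ℕ, ∫ t, t ^ n ∂ν =
      (1 / (S.card : ℝ)) ^ n *
        ∑ σ : Fin n → S, open Classical in if wordProd σ = 1 then (1 : ℝ) else 0 := by
  obtain ⟨E, hE, rfl⟩ := hν
  refine ⟨inferInstance, ?_, fun n => ?_⟩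
  · refine measure_mono_null (Set.compl_subset_compl.2 ?_) (E.measure_compl_Icc hE _)
    exact Set.Icc_subset_Icc (neg_le_neg (norm_markov_le S ⊥)) (norm_markov_le S ⊥)
  · rw [E.integral_pow_measure hE, inner_markov_pow_single]
    congr 1
    refine Finset.sum_congr rfl fun σ _ => ?_
    congr 1
    rw [eq_iff_iff, MulAction.Quotient.smul_coe, QuotientGroup.eq, Subgroup.mem_bot]
    simp

theorem existsUnique_isCayleyKestenMeasure {S : Finset Γ} (hsymm : ∀ s ∈ S, s⁻¹ ∈ S) :
    ∃! ν : Measure ℝ, IsCayleyKestenMeasure S ν := by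
  have hM := isSelfAdjoint_markov hsymm (⊥ : Subgroup Γ)
  refine ⟨_, ⟨spectralMeasure hM, isSpectralMeasureOf_spectralMeasure hM, rfl⟩, ?_⟩
  rintro _ ⟨E, hE, rfl⟩
  rw [E.measure_eq_scalarMeasure hE, measure_spectralMeasure]

end Markov

/-! ### Fixed points on the levels and on the boundary of the tree -/

section Boundary

variable {A : Type*}

theorem Boundary.take_eq_iff {x : Boundary A} {n : ℕ} {u : List A} (hu : u.length = n) :
    x.take n = u ↔ ∀ i < n, u[i]? = some (x i) := by
  constructor
  · rintro rfl i hi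
    simp [Boundary.take, hi]
  · intro h
    refine List.ext_getElem? fun i => ?_
    by_cases hi : i < n
    · rw [h i hi]
      simp [Boundary.take, hi]
    · rw [List.getElem?_eq_none (by rw [Boundary.length_take]; omega),
        List.getElem?_eq_none (by omega)]

theorem Boundary.take_eq_take_iff {x y : Boundary A} {n : ℕ} :
    x.take n = y.take n ↔ ∀ i < n, x i = y i := by
  simp [Boundary.take, List.map_inj_left]

theorem Boundary.setOf_take_eq {n : ℕ} {u : List A} (hu : u.length = n) :
    {x : Boundary A | x.take n = u} =
      Set.pi (Finset.range n : Set ℕ) fun i => {a : A | u[i]? = some a} := by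
  ext x
  rw [Set.mem_ofPred_eq, Boundary.take_eq_iff hu]
  exact ⟨fun h i hi => h i (Finset.mem_range.1 hi), fun h i hi => h i (Finset.mem_range.2 hi)⟩

theorem Boundary.measurableSet_take_eq {n : ℕ} {u : List A} (hu : u.length = n) :
    MeasurableSet {x : Boundary A | x.take n = u} := by
  let _ : MeasurableSpace A := ⊤
  rw [Boundary.setOf_take_eq hu]
  exact MeasurableSet.pi (Finset.countable_toSet _) fun _ _ => trivial

theorem finite_of_length_eq [Finite A] {n : ℕ} {C : Set (List A)} (hC : ∀ u ∈ C, u.length = n) :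
    C.Finite :=
  (List.finite_length_eq A n).subset hC

theorem measurableSet_take_mem [Finite A] {n : ℕ} {C : Set (List A)} (hC : ∀ u ∈ C, u.length = n) :
    MeasurableSet {x : Boundary A | x.take n ∈ C} := by
  have e : {x : Boundary A | x.take n ∈ C} = ⋃ u ∈ C, {x : Boundary A | x.take n = u} := by
    ext x
    simp
  rw [e]
  exact (finite_of_length_eq hC).measurableSet_biUnion
    fun u hu => Boundary.measurableSet_take_eq (hC u hu)

theorem natCard_length_eq (A : Type*) [Finite A] (n : ℕ) :
    Nat.card {u : List A // u.length = n} = Nat.card A ^ n := by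
  have := Fintype.ofFinite A
  rw [Nat.card_eq_fintype_card (α := A), ← card_vector n, ← Nat.card_eq_fintype_card]
  rfl

variable {Γ : Type*} [Group Γ] [MulAction Γ (List A)]

/-- The infinite words whose prefix of length `n` is fixed by `g`. -/
def levelFix (A : Type*) [MulAction Γ (List A)] (g : Γ) (n : ℕ) : Set (Boundary A) :=
  {x | g • x.take n = x.take n}

theorem levelFix_eq (g : Γ) (n : ℕ) :
    levelFix A g n = {x | x.take n ∈ {u : List A | u.length = n ∧ g • u = u}} := by
  ext x
  simp [levelFix, Boundary.length_take]

theorem measurableSet_levelFix [Finite A] (g : Γ) (n : ℕ) : MeasurableSet (levelFix A g n) := by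
  rw [levelFix_eq]
  exact measurableSet_take_mem fun u hu => hu.1

variable [IsRootedTreeAction Γ A]

theorem mem_levelFix_iff {g : Γ} {n : ℕ} {x : Boundary A} :
    x ∈ levelFix A g n ↔ ∀ i < n, (g • x) i = x i := by
  rw [← Boundary.take_eq_take_iff, take_smul]
  rfl

theorem iInter_levelFix (g : Γ) : ⋂ n, levelFix A g n = {x : Boundary A | g • x = x} := by
  ext x
  simp only [Set.mem_iInter, mem_levelFix_iff, Set.mem_ofPred_eq]
  exact ⟨fun h => funext fun i => h (i + 1) i (Nat.lt_succ_self i), fun h _ i _ => by rw [h]⟩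

theorem iInf_stabilizer_take (w : Boundary A) :
    ⨅ k, MulAction.stabilizer Γ (w.take k) = MulAction.stabilizer Γ w := by
  ext g
  simp only [Subgroup.mem_iInf, MulAction.mem_stabilizer_iff]
  have := Set.ext_iff.1 (iInter_levelFix (A := A) g) w
  simpa [levelFix] using this

theorem antitone_levelFix (g : Γ) : Antitone (levelFix A g) := by
  intro m n hmn x hx
  rw [mem_levelFix_iff] at hx ⊢
  exact fun i hi => hx i (hi.trans_le hmn)

/-- By transitivity, the cosets of the stabilizer of a word are in bijection with the words of the
same length. -/
noncomputable def quotientStabilizerEquiv (htrans : SphericallyTransitive Γ A) (u : List A) :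
    Γ ⧸ MulAction.stabilizer Γ u ≃ {v : List A // v.length = u.length} :=
  Equiv.ofBijective
    (fun q => ⟨MulAction.ofQuotientStabilizer Γ u q, by
      induction q using QuotientGroup.induction_on with
      | H g => rw [MulAction.ofQuotientStabilizer_mk, length_smul]⟩)
    ⟨fun _ _ h => MulAction.injective_ofQuotientStabilizer Γ u (congrArg Subtype.val h), by
      rintro ⟨v, hv⟩
      obtain ⟨g, hg⟩ := htrans u v hv.symm
      exact ⟨(g : Γ ⧸ MulAction.stabilizer Γ u), Subtype.ext hg⟩⟩

theorem finite_quotient_stabilizer [Finite A] (htrans : SphericallyTransitive Γ A) (u : List A) :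
    Finite (Γ ⧸ MulAction.stabilizer Γ u) := by
  have : Finite {v : List A // v.length = u.length} := List.finite_length_eq A u.length
  exact Finite.of_equiv _ (quotientStabilizerEquiv htrans u).symm

variable [Finite A] [Nonempty A]

instance : IsProbabilityMeasure (boundaryMeasure A) := by
  let _ : MeasurableSpace A := ⊤
  have : IsProbabilityMeasure (ProbabilityTheory.uniformOn (Set.univ : Set A)) :=
    ProbabilityTheory.isProbabilityMeasure_uniformOn Set.finite_univ Set.univ_nonempty
  exact inferInstanceAs (IsProbabilityMeasure
    (Measure.infinitePi fun _ : ℕ => ProbabilityTheory.uniformOn (Set.univ : Set A)))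

theorem boundaryMeasure_take_eq {n : ℕ} {u : List A} (hu : u.length = n) :
    boundaryMeasure A {x : Boundary A | x.take n = u} = (Nat.card A : ℝ≥0∞)⁻¹ ^ n := by
  let _ : MeasurableSpace A := ⊤
  have := Fintype.ofFinite A
  have : IsProbabilityMeasure (ProbabilityTheory.uniformOn (Set.univ : Set A)) :=
    ProbabilityTheory.isProbabilityMeasure_uniformOn Set.finite_univ Set.univ_nonempty
  rw [Boundary.setOf_take_eq hu, boundaryMeasure]
  refine (Measure.infinitePi_pi _ fun _ _ => MeasurableSpace.measurableSet_top).trans ?_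
  rw [← Finset.card_range n, ← Finset.prod_const, Finset.card_range]
  refine Finset.prod_congr rfl fun i hi => ?_
  have hi' : i < u.length := hu ▸ Finset.mem_range.1 hi
  have e : {a : A | u[i]? = some a} = {u[i]} := by
    ext a
    simp [List.getElem?_eq_getElem hi', eq_comm]
  rw [e, ProbabilityTheory.uniformOn_univ, Measure.count_singleton, one_div,
    Nat.card_eq_fintype_card]

theorem boundaryMeasure_take_mem {n : ℕ} {C : Set (List A)} (hC : ∀ u ∈ C, u.length = n) :
    boundaryMeasure A {x : Boundary A | x.take n ∈ C} =
      Nat.card C * (Nat.card A : ℝ≥0∞)⁻¹ ^ n := by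
  have hfin := finite_of_length_eq hC
  have e : {x : Boundary A | x.take n ∈ C} =
      ⋃ u ∈ hfin.toFinset, {x : Boundary A | x.take n = u} := by
    ext x
    simp
  rw [e, measure_biUnion_finset]
  · rw [Finset.sum_congr rfl fun u hu => boundaryMeasure_take_eq (hC u (hfin.mem_toFinset.1 hu)),
      Finset.sum_const, nsmul_eq_mul, Nat.card_coe_set_eq, Set.ncard_eq_toFinset_card C hfin]
  · intro u _ v _ huv
    refine Set.disjoint_left.2 fun x hx hx' => huv ?_
    exact (show x.take n = u from hx).symm.trans hx'
  · exact fun u hu => Boundary.measurableSet_take_eq (hC u (hfin.mem_toFinset.1 hu))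

theorem tendsto_boundaryMeasure_levelFix (g : Γ) :
    Tendsto (fun n => (boundaryMeasure A).real (levelFix A g n)) atTop
      (𝓝 ((boundaryMeasure A).real {x : Boundary A | g • x = x})) := by
  rw [← iInter_levelFix]
  refine (ENNReal.tendsto_toReal (measure_ne_top _ _)).comp ?_
  exact tendsto_measure_iInter_atTop
    (fun n => (measurableSet_levelFix g n).nullMeasurableSet) (antitone_levelFix g)
    ⟨0, measure_ne_top _ _⟩

/-- The proportion of vertices of the Schreier graph of the `n`-th level fixed by `g` is the measure
of the set of infinite words whose prefix of length `n` is fixed by `g`. -/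
theorem card_fixed_div_card (htrans : SphericallyTransitive Γ A) (w : Boundary A) (n : ℕ) (g : Γ) :
    (Nat.card {v : Γ ⧸ MulAction.stabilizer Γ (w.take n) // g • v = v} : ℝ) /
      Nat.card (Γ ⧸ MulAction.stabilizer Γ (w.take n)) =
        (boundaryMeasure A).real (levelFix A g n) := by
  set e := quotientStabilizerEquiv htrans (w.take n)
  have he (v : Γ ⧸ MulAction.stabilizer Γ (w.take n)) :
      ((e (g • v) : {u : List A // _}) : List A) = g • (e v : List A) :=
    MulAction.ofQuotientStabilizer_smul Γ (w.take n) g v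
  have h1 : Nat.card {v : Γ ⧸ MulAction.stabilizer Γ (w.take n) // g • v = v} =
      Nat.card {u : List A | u.length = n ∧ g • u = u} := by
    refine Nat.card_congr ((e.subtypeEquiv (q := fun u :
      {v : List A // v.length = (w.take n).length} => g • (u : List A) = u) fun v => ?_).trans
      ((Equiv.subtypeSubtypeEquivSubtypeInter _ (fun u : List A => g • u = u)).trans
        (Equiv.subtypeEquivRight fun u => ?_)))
    · rw [← he, ← Subtype.ext_iff, e.injective.eq_iff]
    · rw [Boundary.length_take]
      rfl
  rw [h1, Nat.card_congr e, Boundary.length_take, natCard_length_eq A, levelFix_eq, measureReal_def,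
    boundaryMeasure_take_mem fun u hu => hu.1]
  simp [div_eq_mul_inv]

/-! ### The two spectral measures of the action -/

/-- The moments of the limiting measure: averages of the measures of the sets of fixed points. -/
noncomputable def fixMoment (A : Type*) [MulAction Γ (List A)] [IsRootedTreeAction Γ A] [Finite A]
    [Nonempty A] (S : Finset Γ) (n : ℕ) : ℝ :=
  (1 / (S.card : ℝ)) ^ n *
    ∑ σ : Fin n → S, (boundaryMeasure A).real {x : Boundary A | wordProd σ • x = x}

variable {S : Finset Γ}

theorem tendsto_moment_eigenvalueMeasure (htrans : SphericallyTransitive Γ A)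
    (hsymm : ∀ s ∈ S, s⁻¹ ∈ S) (w : Boundary A) (n : ℕ) :
    Tendsto (fun k => ∫ t, t ^ n ∂(eigenvalueMeasure S (MulAction.stabilizer Γ (w.take k))))
      atTop (𝓝 (fixMoment A S n)) := by
  have h (k : ℕ) : ∫ t, t ^ n ∂(eigenvalueMeasure S (MulAction.stabilizer Γ (w.take k))) =
      (1 / (S.card : ℝ)) ^ n *
        ∑ σ : Fin n → S, (boundaryMeasure A).real (levelFix A (wordProd σ) k) := by
    have := finite_quotient_stabilizer htrans (w.take k)
    rw [integral_pow_eigenvalueMeasure (isSelfAdjoint_markov hsymm _).isSymmetric]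
    simp_rw [card_fixed_div_card htrans]
  simp_rw [h]
  exact (tendsto_finsetSum _ fun σ _ => tendsto_boundaryMeasure_levelFix _).const_mul _

theorem integral_pow_of_isKNSMeasure (htrans : SphericallyTransitive Γ A)
    (hsymm : ∀ s ∈ S, s⁻¹ ∈ S) {w : Boundary A} {μ : Measure ℝ}
    (hμ : IsKNSMeasure S (MulAction.stabilizer Γ w)
      (fun k => MulAction.stabilizer Γ (w.take k)) μ) (n : ℕ) :
    ∫ t, t ^ n ∂μ = fixMoment A S n := by
  have h := hμ.weakly (truncPow 1 zero_le_one n)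
  rw [integral_truncPow _ hμ.supported] at h
  refine tendsto_nhds_unique h ((tendsto_moment_eigenvalueMeasure htrans hsymm w n).congr
    fun k => ?_)
  have := finite_quotient_stabilizer htrans (w.take k)
  exact (integral_truncPow _ (eigenvalueMeasure_compl
    (isSelfAdjoint_markov hsymm _).isSymmetric) n).symm

theorem existsUnique_isKNSMeasure (htrans : SphericallyTransitive Γ A)
    (hsymm : ∀ s ∈ S, s⁻¹ ∈ S) (w : Boundary A) :
    ∃! μ : Measure ℝ, IsKNSMeasure S (MulAction.stabilizer Γ w)
      (fun k => MulAction.stabilizer Γ (w.take k)) μ := by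
  have hfin (k : ℕ) := finite_quotient_stabilizer htrans (w.take k)
  have hsym (k : ℕ) := (isSelfAdjoint_markov hsymm (MulAction.stabilizer Γ (w.take k))).isSymmetric
  have hfm (k : ℕ) : IsFiniteMeasure (eigenvalueMeasure S (MulAction.stabilizer Γ (w.take k))) :=
    isFiniteMeasure_eigenvalueMeasure (hsym k)
  have hcompl (k : ℕ) := eigenvalueMeasure_compl (hsym k)
  have hmom := tendsto_moment_eigenvalueMeasure htrans hsymm w
  obtain ⟨μ, h1, h2, h3⟩ := exists_measure_of_tendsto_moments zero_le_one hcompl hmom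
  refine ⟨μ, ⟨fun k => Subgroup.finiteIndex_of_finite_quotient, iInf_stabilizer_take w, ?_, h2,
    fun f => tendsto_integral_of_tendsto_moments hcompl h2 (fun n => by rw [h3]; exact hmom n)
      f.continuous⟩, fun μ' hμ' => ?_⟩
  · have h0 := h3 0
    simp only [pow_zero, integral_const, smul_eq_mul, mul_one, fixMoment] at h0
    rw [Fintype.sum_unique] at h0
    have e : {x : Boundary A | wordProd (default : Fin 0 → S) • x = x} = Set.univ := by
      ext x
      simp [wordProd]
    rw [e, probReal_univ (μ := boundaryMeasure A), one_mul] at h0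
    constructor
    rw [← ofReal_measureReal, h0, ENNReal.ofReal_one]
  · have := hμ'.isProbabilityMeasure
    exact ext_of_moments hμ'.supported h2 fun n => by
      rw [integral_pow_of_isKNSMeasure htrans hsymm hμ', h3]

open Classical in
/-- Freeness is read off from the moments: each word contributes at least as much to the moment of
the limiting measure as to the return probability. -/
theorem ergodicallyFree_iff_moments (hS : S.Nonempty) (hsymm : ∀ s ∈ S, s⁻¹ ∈ S)
    (hgen : Subgroup.closure (S : Set Γ) = ⊤) :
    ErgodicallyFree Γ A ↔ ∀ n : ℕ, fixMoment A S n = (1 / (S.card : ℝ)) ^ n *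
      ∑ σ : Fin n → S, if wordProd σ = 1 then (1 : ℝ) else 0 := by
  have hone : (boundaryMeasure A).real {x : Boundary A | (1 : Γ) • x = x} = 1 := by simp
  constructor
  · intro hfree n
    rw [fixMoment]
    congr 1
    refine Finset.sum_congr rfl fun σ _ => ?_
    split_ifs with h
    · rw [h, hone]
    · rw [measureReal_def, hfree _ h, ENNReal.toReal_zero]
  · intro h g hg
    obtain ⟨n, σ, rfl⟩ := exists_wordProd_eq hsymm hgen g
    have hcard : (1 / (S.card : ℝ)) ^ n ≠ 0 := by
      have := hS.card_pos
      positivity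
    have hsum := mul_left_cancel₀ hcard (h n)
    have hle : ∀ τ ∈ (Finset.univ : Finset (Fin n → S)), (if wordProd τ = 1 then (1 : ℝ) else 0) ≤
        (boundaryMeasure A).real {x : Boundary A | wordProd τ • x = x} := by
      intro τ _
      split_ifs with hτ
      · rw [hτ, hone]
      · exact measureReal_nonneg
    have h0 := (Finset.sum_eq_sum_iff_of_le hle).1 hsum.symm σ (Finset.mem_univ σ)
    rw [if_neg hg] at h0
    exact (measureReal_eq_zero_iff).1 h0.symm

end Boundary

end TreeSpectra

theorem mainTheorem3 {Γ A : Type*} [Group Γ] [Finite A] [Nonempty A] [MulAction Γ (List A)]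
    [TreeSpectra.IsRootedTreeAction Γ A]
    (htrans : TreeSpectra.SphericallyTransitive Γ A)
    (S : Finset Γ) (hS : S.Nonempty) (hsymm : ∀ s ∈ S, s⁻¹ ∈ S)
    (hgen : Subgroup.closure (S : Set Γ) = ⊤)
    (w : TreeSpectra.Boundary A) :
    (∃! μ : MeasureTheory.Measure ℝ, TreeSpectra.IsKNSMeasure S (MulAction.stabilizer Γ w)
      (fun k => MulAction.stabilizer Γ (w.take k)) μ) ∧
    (∃! ν : MeasureTheory.Measure ℝ, TreeSpectra.IsCayleyKestenMeasure S ν) ∧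
    ∀ μ ν : MeasureTheory.Measure ℝ,
      TreeSpectra.IsKNSMeasure S (MulAction.stabilizer Γ w)
        (fun k => MulAction.stabilizer Γ (w.take k)) μ →
      TreeSpectra.IsCayleyKestenMeasure S ν →
      (μ = ν ↔ TreeSpectra.ErgodicallyFree Γ A) := by
  refine ⟨TreeSpectra.existsUnique_isKNSMeasure htrans hsymm w,
    TreeSpectra.existsUnique_isCayleyKestenMeasure hsymm, fun μ ν hμ hν => ?_⟩
  obtain ⟨hν1, hν2, hν3⟩ := TreeSpectra.integral_pow_of_isCayleyKestenMeasure hν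
  have hμ3 := TreeSpectra.integral_pow_of_isKNSMeasure htrans hsymm hμ
  have := hμ.isProbabilityMeasure
  rw [TreeSpectra.ergodicallyFree_iff_moments hS hsymm hgen]
  constructor
  · rintro rfl n
    rw [← hμ3, hν3]
  · intro h
    exact TreeSpectra.ext_of_moments hμ.supported hν2 fun n => by rw [hμ3, h, hν3]
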